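/- Let $\Sigma$ be a finite alphabet. A \emph{pangram} over $\Sigma$ is a word $w\in\Sigma^*$ in which every letter of $\Sigma$ occurs at least once. A \emph{2-SLT acceptor} over $\Sigma$ is a triple $A=(S,I,E)$ with $S,E\subseteq\Sigma$ and $I\subseteq\Sigma^2$; its size is $|A|=|S|+|I|+|E|$, and its language $L(A)$ (a local, or 2-strictly locally testable, language) consists of all words $w\in\Sigma^*$ whose first letter exists and lies in $S$, whose last letter lies in $E$, and all of whose factors of length two lie in $I$. The \emph{pangram problem for 2-SLT} is: given $\Sigma$ and a 2-SLT acceptor $A$ over $\Sigma$, decide whether $L(A)$ contains a pangram over $\Sigma$. The \emph{letter graph} of $A$ is the directed graph with vertex set $\Sigma$ and edge set $I$. Its \emph{condensation} has the strongly connected components of the letter graph as vertices, and an edge from $C$ to $D\neq C$ iff some $(a,b)\in I$ has $a\in C$, $b\in D$. A \emph{Hamiltonian path} is a sequence of vertices that contains every vertex exactly once and in which consecutive vertices are joined by an edge; a \emph{topological order} is a sequence that contains every vertex exactly once and in which every edge of the graph points from an earlier to a later vertex; a topological order is \emph{linear} if any two consecutive members are joined by an edge. A sequence of components \emph{leads from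 $S$ to $E$} if it is nonempty, its first component contains a letter of $S$ and its last component contains a letter of $E$. **Theorem.** 1. The pangram problem for 2-SLT is solvable in linear time: there are one program of a unit-cost random-access machine (whose arithmetic operations are addition and truncated subtraction) and one constant $c$ such that, for every alphabet $\Sigma$ (with letters numbered $0,\dots,|\Sigma|-1$) and every acceptor $A=(S,I,E)$ over it (the three sets being listed in any order without repetition), the program halts with the correct yes/no answer after at most $c\,(N+1)$ steps, where $N=|A|+|\Sigma|$, and only writes numbers that are at most $c\,(N+1)$. 2. For every 2-SLT acceptor $A=(S,I,E)$ over a finite alphabet, the following are equivalent: (a) $L(A)$ contains a pangram; (b) the condensation of the letter graph has a Hamiltonian path that leads from $S$ to $E$; (c) the condensation of the letter graph has a linear topological order that leads from $S$ to $E$. Moreover, every Hamiltonian path of the condensation is a topological order of it, and is its only topological order. -/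

import Mathlib

universe u

/-! ### Strongly connected components, condensation, Hamiltonian paths, topological orders -/

namespace Digraph

variable {V : Type u}

/-- The quiver with exactly one arrow from `a` to `b` for every edge `a → b` of `G`. -/
@[reducible] def edgeQuiver (G : Digraph V) : Quiver V where
  Hom a b := PLift (G.Adj a b)

/-- The strongly connected components of `G`: classes of mutually reachable vertices. -/
def SCC (G : Digraph V) : Type u :=
  @Quiver.StronglyConnectedComponent V G.edgeQuiver

/-- The strongly connected component of a vertex. -/
def toSCC (G : Digraph V) (v : V) : G.SCC :=
  @Quiver.StronglyConnectedComponent.mk V G.edgeQuiver v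

/-- The condensation of `G`: every strongly connected component is contracted to one vertex, and
there is an edge between two distinct components iff `G` has an edge from a vertex of the first
one to a vertex of the second one. -/
def condensation (G : Digraph V) : Digraph G.SCC where
  Adj C D := C ≠ D ∧ ∃ a b : V, G.toSCC a = C ∧ G.toSCC b = D ∧ G.Adj a b

/-- A list of vertices every two consecutive members of which are joined by an edge. -/
def IsWalk (G : Digraph V) (p : List V) : Prop :=
  p.IsChain G.Adj

/-- The list contains every vertex exactly once. -/
def IsVertexEnumeration (_G : Digraph V) (p : List V) : Prop :=
  p.Nodup ∧ ∀ v : V, v ∈ p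

/-- A walk that visits every vertex exactly once. -/
def IsHamiltonianPath (G : Digraph V) (p : List V) : Prop :=
  G.IsWalk p ∧ G.IsVertexEnumeration p

/-- An enumeration of all the vertices in which every edge points from an earlier to a later
vertex. -/
def IsTopologicalOrder (G : Digraph V) (p : List V) : Prop :=
  G.IsVertexEnumeration p ∧ ∀ i j : Fin p.length, G.Adj (p.get i) (p.get j) → i < j

end Digraph

/-! ### Pangrams and 2-strictly locally testable languages -/

/-- The set of pangrams over the alphabet `α`: words in which every letter occurs. -/
def pangrams (α : Type u) : Language α :=
  {w : List α | ∀ a : α, a ∈ w}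

/-- An acceptor of the class 2-SLT: a triple `(S, I, E)` of sets of permitted first letters,
permitted pairs of neighbours, and permitted last letters. -/
structure SLT2 (α : Type u) where
  S : Finset α
  I : Finset (α × α)
  E : Finset α

namespace SLT2

variable {α : Type u}

/-- The size `|S| + |I| + |E|` of an acceptor. -/
def size (A : SLT2 α) : ℕ :=
  A.S.card + A.I.card + A.E.card

/-- The local language denoted by `(S, I, E)`: the words that have a prefix of length one in `S`,
a suffix of length one in `E`, and all of whose contiguous subwords of length two are in `I`. -/
def language (A : SLT2 α) : Language α :=
  {w : List α | (∃ a ∈ A.S, [a] <+: w) ∧ (∃ b ∈ A.E, [b] <:+ w) ∧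
    ∀ a b : α, [a, b] <:+: w → (a, b) ∈ A.I}

/-- The pangram problem: does the language of the acceptor contain a pangram? -/
def HasPangram (A : SLT2 α) : Prop :=
  ∃ w : List α, w ∈ A.language ∧ w ∈ pangrams α

/-- The letter graph: the vertices are the letters and the edges are the pairs in `I`. -/
def letterGraph (A : SLT2 α) : Digraph α where
  Adj a b := (a, b) ∈ A.I

/-- A component of the letter graph that contains a letter of `S`. -/
def IsSComponent (A : SLT2 α) (C : A.letterGraph.SCC) : Prop :=
  ∃ a ∈ A.S, A.letterGraph.toSCC a = C

/-- A component of the letter graph that contains a letter of `E`. -/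
def IsEComponent (A : SLT2 α) (C : A.letterGraph.SCC) : Prop :=
  ∃ a ∈ A.E, A.letterGraph.toSCC a = C

/-- The list of components is nonempty, its first member is an `S`-component and its last member
is an `E`-component. -/
def LeadsFromSToE (A : SLT2 α) (p : List A.letterGraph.SCC) : Prop :=
  (∃ C ∈ p.head?, A.IsSComponent C) ∧ (∃ D ∈ p.getLast?, A.IsEComponent D)

end SLT2

/-! ### A word random-access machine with step count

A program uses finitely many registers and finitely many arrays (each program names its registers
and arrays by constants); array cells are addressed by register contents. The operations are
those of a random-access machine with copying, addition and truncated subtraction only, and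
every operation and every test takes one step. Each cell holds a natural number that is at most
`W`, where `W` is the largest number that fits into a machine word; a computation in which an
operation produces a larger number gets stuck. -/

namespace RAM

/-- Registers and arrays; `mem k i` is cell `i` of array `k`. -/
structure State where
  reg : ℕ → ℕ
  mem : ℕ → ℕ → ℕ

/-- Writing into a register. -/
def State.setReg (s : State) (r v : ℕ) : State :=
  { s with reg := Function.update s.reg r v }

/-- Writing into a cell of an array. -/
def State.setMem (s : State) (k i v : ℕ) : State :=
  { s with mem := Function.update s.mem k (Function.update (s.mem k) i v) }

/-- Operands: constants and registers. -/
inductive Arg where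
  | lit (n : ℕ)
  | reg (r : ℕ)

def Arg.val (s : State) : Arg → ℕ
  | .lit n => n
  | .reg r => s.reg r

/-- Comparisons of two operands. -/
inductive Test where
  | eq (a b : Arg)
  | ne (a b : Arg)
  | lt (a b : Arg)
  | le (a b : Arg)

def Test.Holds (s : State) : Test → Prop
  | .eq a b => a.val s = b.val s
  | .ne a b => a.val s ≠ b.val s
  | .lt a b => a.val s < b.val s
  | .le a b => a.val s ≤ b.val s

/-- Programs. -/
inductive Prog where
  /-- no operation -/
  | skip
  /-- `reg r := a` -/
  | move (r : ℕ) (a : Arg)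
  /-- `reg r := a + b` -/
  | add (r : ℕ) (a b : Arg)
  /-- `reg r := max (a - b) 0` -/
  | sub (r : ℕ) (a b : Arg)
  /-- `reg r := mem k a` -/
  | load (r k : ℕ) (a : Arg)
  /-- `mem k a := b` -/
  | store (k : ℕ) (a b : Arg)
  /-- sequential composition -/
  | seq (P Q : Prog)
  /-- conditional -/
  | ite (b : Test) (P Q : Prog)
  /-- loop -/
  | loop (b : Test) (P : Prog)

/-- `Exec W P s t s'`: with largest machine word `W`, the program `P` started in state `s` halts
after exactly `t` steps in state `s'`, and all numbers that it writes are at most `W`. -/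
inductive Exec (W : ℕ) : Prog → State → ℕ → State → Prop
  | skip (s : State) : Exec W .skip s 1 s
  | move (s : State) (r : ℕ) (a : Arg) (h : a.val s ≤ W) :
      Exec W (.move r a) s 1 (s.setReg r (a.val s))
  | add (s : State) (r : ℕ) (a b : Arg) (h : a.val s + b.val s ≤ W) :
      Exec W (.add r a b) s 1 (s.setReg r (a.val s + b.val s))
  | sub (s : State) (r : ℕ) (a b : Arg) (h : a.val s - b.val s ≤ W) :
      Exec W (.sub r a b) s 1 (s.setReg r (a.val s - b.val s))
  | load (s : State) (r k : ℕ) (a : Arg) (h : s.mem k (a.val s) ≤ W) :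
      Exec W (.load r k a) s 1 (s.setReg r (s.mem k (a.val s)))
  | store (s : State) (k : ℕ) (a b : Arg) (h : b.val s ≤ W) :
      Exec W (.store k a b) s 1 (s.setMem k (a.val s) (b.val s))
  | seq {P Q : Prog} {s s' s'' : State} {t t' : ℕ}
      (h : Exec W P s t s') (h' : Exec W Q s' t' s'') :
      Exec W (.seq P Q) s (t + t') s''
  | ite_true {b : Test} {P Q : Prog} {s s' : State} {t : ℕ}
      (hb : b.Holds s) (h : Exec W P s t s') : Exec W (.ite b P Q) s (1 + t) s'
  | ite_false {b : Test} {P Q : Prog} {s s' : State} {t : ℕ}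
      (hb : ¬ b.Holds s) (h : Exec W Q s t s') : Exec W (.ite b P Q) s (1 + t) s'
  | loop_exit {b : Test} {P : Prog} {s : State}
      (hb : ¬ b.Holds s) : Exec W (.loop b P) s 1 s
  | loop_step {b : Test} {P : Prog} {s s' s'' : State} {t t' : ℕ}
      (hb : b.Holds s) (h : Exec W P s t s') (h' : Exec W (.loop b P) s' t' s'') :
      Exec W (.loop b P) s (1 + t + t') s''

/-- The decision problem `Q` with instances in `ι`, given to the machine through `encode` and
measured by `size`, is solvable in linear time: there are one program and one constant `c` such
that on every instance `x` the program halts after at most `c * (size x + 1)` steps, working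
with numbers that are at most `c * (size x + 1)` only (so machine words have
`log (size x) + O(1)` bits), and leaves the answer, `1` for yes and `0` for no, in register
`0`. -/
def SolvableInLinearTime {ι : Type u} (encode : ι → State) (size : ι → ℕ) (Q : ι → Prop) :
    Prop :=
  ∃ (P : Prog) (c : ℕ), ∀ x : ι, ∃ (t : ℕ) (s : State),
    Exec (c * (size x + 1)) P (encode x) t s ∧ t ≤ c * (size x + 1) ∧
      (Q x → s.reg 0 = 1) ∧ (¬ Q x → s.reg 0 = 0)

end RAM

/-! ### Instances of the pangram problem for 2-SLT as inputs of the machine -/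

/-- An input: an alphabet, whose `n` letters are numbered from `0` to `n - 1`, and an acceptor
`(S, I, E)` over it, each of whose three sets is listed in an arbitrary order without
repetition. -/
structure SLT2Input where
  n : ℕ
  listS : List (Fin n)
  listI : List (Fin n × Fin n)
  listE : List (Fin n)
  nodupS : listS.Nodup
  nodupI : listI.Nodup
  nodupE : listE.Nodup

namespace SLT2Input

/-- The acceptor that the input describes. -/
def acceptor (x : SLT2Input) : SLT2 (Fin x.n) where
  S := x.listS.toFinset
  I := x.listI.toFinset
  E := x.listE.toFinset

/-- The size of the acceptor plus the size of the alphabet. -/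
def size (x : SLT2Input) : ℕ :=
  x.acceptor.size + x.n

/-- Registers `0, 1, 2, 3` hold the number of letters, `|S|`, `|I|`, and `|E|`; array `0` holds
the list of `S`, arrays `1` and `2` hold the first and the second components of the list of `I`,
array `3` holds the list of `E`; everything else is `0`. -/
def encode (x : SLT2Input) : RAM.State where
  reg r := [x.n, x.listS.length, x.listI.length, x.listE.length].getD r 0
  mem k i :=
    ([x.listS.map Fin.val,
      x.listI.map (fun e => (e.1 : ℕ)),
      x.listI.map (fun e => (e.2 : ℕ)),
      x.listE.map Fin.val].getD k []).getD i 0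

end SLT2Input

/-!
The second part rests on two facts. Reachability between letters is a preorder whose classes are the
strongly connected components, and `A.HasPangram` says that this preorder is total, with a letter of
`S` at the bottom and a letter of `E` at the top (`SLT2.hasPangram_iff_total`): a pangram lists the
letters in the order of reachability, and a list of successively reachable letters can be filled up
to a walk. The condensation is acyclic (`Digraph.condensation_acyclic`), and in an acyclic digraph
a Hamiltonian path is the only topological order, because it makes reachability a total order. A
pangram visits the components along such a path once repetitions are removed. Conversely, a
Hamiltonian path numbers the components so that consecutive ones are joined by an edge, and so makes
reachability total (`SLT2.hasPangram_of_level`).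

The machine decides the criterion in the form of `SLT2.hasPangram_iff_of_level`: for components
numbered `1, …, c` in a topological order, consecutive components are joined by edges, the first one
contains a letter of `S`, and the last one a letter of `E`. The numbering comes from Kosaraju's
algorithm: a depth-first search produces the reverse order of finishing, and the trees of a second
search, in the reversed graph with roots taken in this order, are the components
(`EdgeList.IsDfsResult.reach_of_mark_eq`). What the second search needs to know about the first is
that if an edge leads from `u` to a vertex `v` that finishes later, then `v` reaches everything that
finishes between `u` and `v`: such a `v` is on the stack when `u` finishes. This is part of the
invariant `EdgeList.Dfs.Inv`, which every step of a search with an explicit stack preserves, while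
`EdgeList.Dfs.measure` decreases and bounds the number of steps linearly.

The program is verified with weakest preconditions for its loop-free parts (`RAM.runs_of_wp`) and
one rule for loops with a decreasing measure (`RAM.runs_loop`); both searches are instances of
`RAM.runs_search`.
-/

open Relation

/-! ### Reachability and the condensation -/

namespace Digraph

variable {V : Type u} {G : Digraph V}

/-- There is a directed walk, possibly of length zero, from the first vertex to the second. -/
abbrev Reach (G : Digraph V) : V → V → Prop :=
  ReflTransGen G.Adj

theorem reach_iff_nonempty_path {a b : V} :
    G.Reach a b ↔ Nonempty (@Quiver.Path V G.edgeQuiver a b) := by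
  let := G.edgeQuiver
  constructor
  · intro h
    induction h with
    | refl => exact ⟨Quiver.Path.nil⟩
    | tail _ hbc ih => exact ⟨ih.some.cons ⟨hbc⟩⟩
  · rintro ⟨p⟩
    induction p with
    | nil => exact .refl
    | cons _ e ih => exact ih.tail e.down

theorem toSCC_eq_iff {a b : V} :
    G.toSCC a = G.toSCC b ↔ G.Reach a b ∧ G.Reach b a := by
  let := G.edgeQuiver
  rw [reach_iff_nonempty_path, reach_iff_nonempty_path]
  exact Quiver.StronglyConnectedComponent.eq a b

theorem toSCC_surjective : Function.Surjective G.toSCC := by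
  intro C
  exact Quotient.exists_rep C

theorem reach_of_reach_condensation {C D : G.SCC} (h : G.condensation.Reach C D) :
    ∀ {a b : V}, G.toSCC a = C → G.toSCC b = D → G.Reach a b := by
  induction h with
  | refl => intro a b ha hb; exact (toSCC_eq_iff.1 (ha.trans hb.symm)).1
  | tail _ hDE ih =>
    intro a b ha hb
    obtain ⟨-, c, d, hc, hd, hcd⟩ := hDE
    exact ((ih ha hc).tail hcd).trans (toSCC_eq_iff.1 (hd.trans hb.symm)).1

theorem condensation_acyclic (C : G.SCC) : ¬ TransGen G.condensation.Adj C C := by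
  intro h
  obtain ⟨D, hCD, hDC⟩ := TransGen.head'_iff.1 h
  obtain ⟨hne, a, b, rfl, rfl, hab⟩ := hCD
  exact hne (toSCC_eq_iff.2 ⟨.single hab, reach_of_reach_condensation hDC rfl rfl⟩)

theorem IsWalk.pairwise_transGen {p : List V} (hp : G.IsWalk p) : p.Pairwise (TransGen G.Adj) :=
  List.isChain_iff_pairwise.1 (List.IsChain.imp (fun _ _ h => TransGen.single h) hp)

/-- In an acyclic digraph a Hamiltonian path is a topological order: a backward edge would close
a cycle with the part of the path between its ends. -/
theorem IsHamiltonianPath.isTopologicalOrder (hG : ∀ v, ¬ TransGen G.Adj v v) {p : List V}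
    (hp : G.IsHamiltonianPath p) : G.IsTopologicalOrder p := by
  refine ⟨hp.2, fun i j hij => ?_⟩
  by_contra hlt
  rcases (not_lt.1 hlt).lt_or_eq with h | h
  · exact hG _ ((List.pairwise_iff_getElem.1 hp.1.pairwise_transGen j i j.2 i.2 h).tail hij)
  · subst h
    exact hG _ (.single hij)

theorem IsTopologicalOrder.not_transGen {q : List V} (hq : G.IsTopologicalOrder q)
    {i j : Fin q.length} (hij : i ≤ j) : ¬ TransGen G.Adj (q.get j) (q.get i) := by
  suffices h : ∀ {a b : V}, TransGen G.Adj a b → ∀ i j, q.get j = a → q.get i = b → j < i from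
    fun h' => absurd (h h' i j rfl rfl) (not_lt.2 hij)
  intro a b hab
  induction hab with
  | single h => rintro i j rfl rfl; exact hq.2 _ _ h
  | @tail b c _ hbc ih =>
    rintro i j hj rfl
    obtain ⟨k, rfl⟩ := List.get_of_mem (hq.1.2 b)
    exact (ih k j hj rfl).trans (hq.2 _ _ hbc)

/-- A Hamiltonian path orders all vertices totally by reachability, which leaves only one
topological order. -/
theorem IsTopologicalOrder.eq_of_isHamiltonianPath (hG : ∀ v, ¬ TransGen G.Adj v v) {p q : List V}
    (hq : G.IsTopologicalOrder q) (hp : G.IsHamiltonianPath p) : q = p := by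
  have hpp := hp.1.pairwise_transGen
  refine List.Perm.eq_of_pairwise (le := TransGen G.Adj)
    (fun a b _ _ h h' => absurd (h.trans h') (hG a)) ?_ hpp
    ((List.perm_ext_iff_of_nodup hq.1.1 hp.2.1).2 fun a => iff_of_true (hq.1.2 a) (hp.2.2 a))
  rw [List.pairwise_iff_getElem]
  intro i j hi hj hij
  obtain ⟨k, hk, hki⟩ := List.getElem_of_mem (hp.2.2 q[i])
  obtain ⟨l, hl, hlj⟩ := List.getElem_of_mem (hp.2.2 q[j])
  rcases lt_trichotomy k l with h | h | h
  · rw [← hki, ← hlj]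
    exact List.pairwise_iff_getElem.1 hpp k l hk hl h
  · subst h
    exact absurd ((hq.1.1.getElem_inj_iff).1 (hki.symm.trans hlj)) hij.ne
  · refine absurd ?_ (hq.not_transGen (i := ⟨i, hi⟩) (j := ⟨j, hj⟩) hij.le)
    rw [List.get_eq_getElem, List.get_eq_getElem, ← hki, ← hlj]
    exact List.pairwise_iff_getElem.1 hpp l k hl hk h

end Digraph

/-! ### Pangrams and the reachability preorder -/

namespace List

variable {β : Type u} {r : β → β → Prop}

/-- A list whose members are successively reachable can be refined to a walk. -/
theorem exists_isChain_of_isChain_reflTransGen {a : β} {l : List β}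
    (h : (a :: l).IsChain (ReflTransGen r)) :
    ∃ w : List β, w.IsChain r ∧ w.head? = some a ∧ w.getLast? = (a :: l).getLast? ∧
      ∀ x ∈ a :: l, x ∈ w := by
  induction l generalizing a with
  | nil => exact ⟨[a], .singleton a, rfl, rfl, fun x hx => hx⟩
  | cons b l ih =>
    obtain ⟨hab, hbl⟩ := isChain_cons_cons.1 h
    obtain ⟨w, hw, hhead, hlast, hmem⟩ := ih hbl
    rw [getLast?_cons_cons, ← hlast]
    clear hlast h hbl ih
    induction hab using ReflTransGen.head_induction_on with
    | refl => exact ⟨w, hw, hhead, rfl, by simpa using hmem⟩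
    | @head a c hac _ ih =>
      obtain ⟨w', hw', hhead', hlast', hmem'⟩ := ih
      refine ⟨a :: w', isChain_cons.2 ⟨fun y hy => ?_, hw'⟩, rfl, ?_, ?_⟩
      · rw [hhead', Option.mem_some_iff] at hy
        exact hy ▸ hac
      · cases w' with
        | nil => simp at hhead'
        | cons d w' => rw [getLast?_cons_cons, hlast']
      · rintro x (_ | ⟨_, hx⟩)
        · exact mem_cons_self
        · exact mem_cons_of_mem _ (hmem' x (mem_cons_of_mem _ hx))

/-- Stuttering steps can be removed from a walk. -/
theorem exists_isChain_of_isChain_eq_or {l : List β} (h : l.IsChain fun a b => a = b ∨ r a b) :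
    ∃ p : List β, p.IsChain r ∧ p.head? = l.head? ∧ p.getLast? = l.getLast? ∧
      ∀ x, x ∈ p ↔ x ∈ l := by
  induction l with
  | nil => exact ⟨[], .nil, rfl, rfl, fun _ => Iff.rfl⟩
  | cons a l ih =>
    cases l with
    | nil => exact ⟨[a], .singleton a, rfl, rfl, fun _ => Iff.rfl⟩
    | cons b l =>
      obtain ⟨hab, hbl⟩ := isChain_cons_cons.1 h
      obtain ⟨p, hp, hhead, hlast, hmem⟩ := ih hbl
      rcases hab with rfl | hab
      · exact ⟨p, hp, hhead, by rw [hlast, getLast?_cons_cons], by simpa using hmem⟩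
      · refine ⟨a :: p, isChain_cons.2 ⟨fun y hy => ?_, hp⟩, rfl, ?_, ?_⟩
        · rw [hhead, head?_cons, Option.mem_some_iff] at hy
          exact hy ▸ hab
        · cases p with
          | nil => simp at hhead
          | cons d p => rw [getLast?_cons_cons, hlast, getLast?_cons_cons]
        · intro x
          rw [mem_cons, mem_cons, hmem]

end List

namespace SLT2

open Digraph

variable {α : Type u} {A : SLT2 α}

theorem mem_language_iff {w : List α} : w ∈ A.language ↔
    (∃ a ∈ A.S, w.head? = some a) ∧ (∃ b ∈ A.E, w.getLast? = some b) ∧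
      w.IsChain A.letterGraph.Adj := by
  have h1 (a : α) : [a] <+: w ↔ w.head? = some a := by
    cases w with
    | nil => simp
    | cons b w => simp [eq_comm]
  have h2 (a : α) : [a] <:+ w ↔ w.getLast? = some a := by
    constructor
    · rintro ⟨t, rfl⟩
      simp
    · intro h
      obtain ⟨t, rfl⟩ := List.getLast?_eq_some_iff.1 h
      exact ⟨t, rfl⟩
  have h3 : (∀ a b : α, [a, b] <:+: w → (a, b) ∈ A.I) ↔ w.IsChain A.letterGraph.Adj := by
    constructor
    · intro h
      exact (List.isChain_isInfix w).imp fun a b hab => h a b hab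
    · intro h a b hab
      simpa [letterGraph] using h.infix hab
  change ((∃ a ∈ A.S, [a] <+: w) ∧ (∃ b ∈ A.E, [b] <:+ w) ∧
    ∀ a b : α, [a, b] <:+: w → (a, b) ∈ A.I) ↔ _
  simp only [h1, h2, h3]

/-- A pangram exists iff reachability is a total preorder in which a letter of `S` is least and a
letter of `E` is greatest: a pangram lists the letters in the order of reachability, and
conversely the letters sorted by reachability can be joined up to a pangram. -/
theorem hasPangram_iff_total [Finite α] : A.HasPangram ↔
    ∃ s ∈ A.S, ∃ e ∈ A.E, (∀ a, A.letterGraph.Reach s a) ∧ (∀ a, A.letterGraph.Reach a e) ∧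
      ∀ a b, A.letterGraph.Reach a b ∨ A.letterGraph.Reach b a := by
  classical
  constructor
  · rintro ⟨w, hw, hpan⟩
    obtain ⟨⟨s, hs, hhead⟩, ⟨e, he, hlast⟩, hchain⟩ := mem_language_iff.1 hw
    have hpw : w.Pairwise A.letterGraph.Reach :=
      List.isChain_iff_pairwise.1 (hchain.imp fun _ _ h => .single h)
    refine ⟨s, hs, e, he, fun a => ?_, fun a => ?_, fun a b => ?_⟩
    · obtain ⟨t, rfl⟩ := List.head?_eq_some_iff.1 hhead
      rcases List.mem_cons.1 (hpan a) with rfl | ha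
      · exact .refl
      · exact (List.pairwise_cons.1 hpw).1 a ha
    · obtain ⟨t, rfl⟩ := List.getLast?_eq_some_iff.1 hlast
      rcases List.mem_append.1 (hpan a) with ha | ha
      · exact (List.pairwise_append.1 hpw).2.2 a ha e (by simp)
      · rw [List.mem_singleton.1 ha]
    · obtain ⟨i, hi, rfl⟩ := List.getElem_of_mem (hpan a)
      obtain ⟨j, hj, rfl⟩ := List.getElem_of_mem (hpan b)
      rcases lt_trichotomy i j with h | h | h
      · exact .inl (List.pairwise_iff_getElem.1 hpw i j hi hj h)
      · subst h
        exact .inl .refl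
      · exact .inr (List.pairwise_iff_getElem.1 hpw j i hj hi h)
  · rintro ⟨s, hs, e, he, hsa, hae, htot⟩
    have := Fintype.ofFinite α
    have : Std.Total A.letterGraph.Reach := ⟨htot⟩
    set l := Finset.univ.toList.insertionSort A.letterGraph.Reach with hl
    have hmem : ∀ a, a ∈ l := fun a => by simp [hl]
    have hpw : (s :: (l ++ [e])).Pairwise A.letterGraph.Reach := by
      refine List.pairwise_cons.2 ⟨fun a _ => hsa a, List.pairwise_append.2
        ⟨List.pairwise_insertionSort _ _, List.pairwise_singleton _ _, fun a _ b hb => ?_⟩⟩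
      rw [List.mem_singleton.1 hb]
      exact hae a
    obtain ⟨w, hw, hhead, hlast, hsub⟩ :=
      List.exists_isChain_of_isChain_reflTransGen hpw.isChain
    refine ⟨w, mem_language_iff.2 ⟨⟨s, hs, hhead⟩, ⟨e, he, ?_⟩, hw⟩, fun a => hsub a ?_⟩
    · rw [hlast, ← List.cons_append, List.getLast?_append]
      simp
    · simp [hmem a]

/-- If the letters carry levels `1, …, c` such that letters of equal level reach each other and
consecutive levels are joined by an edge, then there is a pangram. -/
theorem hasPangram_of_level [Finite α] (lvl : α → ℕ) (c : ℕ)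
    (hlvl : ∀ a, 1 ≤ lvl a ∧ lvl a ≤ c)
    (heq : ∀ a b, lvl a = lvl b → A.letterGraph.Reach a b)
    (hS : ∃ s ∈ A.S, lvl s = 1) (hE : ∃ e ∈ A.E, lvl e = c)
    (hstep : ∀ k, 1 ≤ k → k < c → ∃ a b, A.letterGraph.Adj a b ∧ lvl a = k ∧ lvl b = k + 1) :
    A.HasPangram := by
  have hle : ∀ d a b, lvl b = lvl a + d → A.letterGraph.Reach a b := by
    intro d
    induction d with
    | zero => intro a b h; exact heq a b h.symm
    | succ d ih =>
      intro a b h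
      obtain ⟨x, y, hxy, hx, hy⟩ := hstep (lvl a + d) (by have := hlvl a; omega)
        (by have := hlvl b; omega)
      exact ((ih a x hx).tail hxy).trans (heq y b (by omega))
  have hle' : ∀ a b, lvl a ≤ lvl b → A.letterGraph.Reach a b := fun a b h =>
    hle (lvl b - lvl a) a b (by omega)
  obtain ⟨s, hs, hs1⟩ := hS
  obtain ⟨e, he, hec⟩ := hE
  exact hasPangram_iff_total.2 ⟨s, hs, e, he, fun a => hle' _ _ (hs1 ▸ (hlvl a).1),
    fun a => hle' _ _ (hec ▸ (hlvl a).2), fun a b => (le_total (lvl a) (lvl b)).imp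
      (hle' a b) (hle' b a)⟩

/-- The criterion that the machine tests, for a numbering `1, …, c` of the strongly connected
components in a topological order. -/
theorem hasPangram_iff_of_level [Finite α] (lvl : α → ℕ) (c : ℕ)
    (hlvl : ∀ a, 1 ≤ lvl a ∧ lvl a ≤ c) (hsurj : ∀ k, 1 ≤ k → k ≤ c → ∃ a, lvl a = k)
    (heq : ∀ a b, lvl a = lvl b → A.letterGraph.Reach a b)
    (hmono : ∀ a b, A.letterGraph.Adj a b → lvl a ≤ lvl b) :
    A.HasPangram ↔ (∃ s ∈ A.S, lvl s = 1) ∧ (∃ e ∈ A.E, lvl e = c) ∧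
      ∀ k, 1 ≤ k → k < c → ∃ a b, A.letterGraph.Adj a b ∧ lvl a = k ∧ lvl b = k + 1 := by
  refine ⟨fun h => ?_, fun ⟨hS, hE, hstep⟩ => hasPangram_of_level lvl c hlvl heq hS hE hstep⟩
  obtain ⟨s, hs, e, he, hsa, hae, htot⟩ := hasPangram_iff_total.1 h
  have hmono' : ∀ {a b}, A.letterGraph.Reach a b → lvl a ≤ lvl b := by
    intro a b hab
    induction hab with
    | refl => exact le_rfl
    | tail _ hbc ih => exact ih.trans (hmono _ _ hbc)
  have hc : 1 ≤ c := (hlvl s).1.trans (hlvl s).2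
  refine ⟨⟨s, hs, ?_⟩, ⟨e, he, ?_⟩, fun k hk hkc => ?_⟩
  · obtain ⟨a, ha⟩ := hsurj 1 le_rfl hc
    exact le_antisymm (ha ▸ hmono' (hsa a)) (hlvl s).1
  · obtain ⟨a, ha⟩ := hsurj c hc le_rfl
    exact le_antisymm (hlvl e).2 (ha ▸ hmono' (hae a))
  · obtain ⟨a, ha⟩ := hsurj k hk hkc.le
    obtain ⟨b, hb⟩ := hsurj (k + 1) (by omega) hkc
    have hab : A.letterGraph.Reach a b := (htot a b).resolve_right fun h => by
      have := hmono' h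
      omega
    -- The levels along a walk from `a` to `b` rise from `k` to `k + 1`, so one edge makes the step.
    induction hab with
    | refl => omega
    | @tail x y hax hxy ih =>
      have h1 := hmono' hax
      have h2 := hmono _ _ hxy
      rcases (by omega : lvl x = k ∨ lvl x = k + 1) with h | h
      · exact ⟨x, y, hxy, h, hb⟩
      · exact ih h

/-! ### Pangrams and Hamiltonian paths of the condensation -/

theorem HasPangram.exists_isHamiltonianPath (h : A.HasPangram) :
    ∃ p : List A.letterGraph.SCC,
      A.letterGraph.condensation.IsHamiltonianPath p ∧ A.LeadsFromSToE p := by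
  obtain ⟨w, hw, hpan⟩ := h
  obtain ⟨⟨s, hs, hhead⟩, ⟨e, he, hlast⟩, hchain⟩ := mem_language_iff.1 hw
  have hq : (w.map A.letterGraph.toSCC).IsChain
      fun C D => C = D ∨ A.letterGraph.condensation.Adj C D := by
    rw [List.isChain_map]
    exact hchain.imp fun a b hab => or_iff_not_imp_left.2 fun hne => ⟨hne, a, b, rfl, rfl, hab⟩
  obtain ⟨p, hp, hphead, hplast, hpmem⟩ := List.exists_isChain_of_isChain_eq_or hq
  refine ⟨p, ⟨hp, ?_, fun C => ?_⟩, ⟨_, ?_, s, hs, rfl⟩, ⟨_, ?_, e, he, rfl⟩⟩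
  · refine (Digraph.IsWalk.pairwise_transGen hp).imp ?_
    rintro C _ hCD rfl
    exact condensation_acyclic C hCD
  · obtain ⟨a, rfl⟩ := toSCC_surjective C
    exact (hpmem _).2 (List.mem_map_of_mem (hpan a))
  · rw [hphead, List.head?_map, hhead]
    rfl
  · rw [hplast, List.getLast?_map, hlast]
    rfl

theorem hasPangram_of_isHamiltonianPath [Finite α] {p : List A.letterGraph.SCC}
    (hp : A.letterGraph.condensation.IsHamiltonianPath p) (hSE : A.LeadsFromSToE p) :
    A.HasPangram := by
  classical
  obtain ⟨⟨C, hC, s, hs, rfl⟩, ⟨D, hD, e, he, rfl⟩⟩ := hSE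
  have hpos (i : ℕ) (hi : i < p.length) : p.idxOf p[i] = i := hp.2.1.idxOf_getElem i hi
  refine hasPangram_of_level (fun a => p.idxOf (A.letterGraph.toSCC a) + 1) p.length
    (fun a => ⟨by omega, List.idxOf_lt_length_of_mem (hp.2.2 _)⟩) (fun a b hab => ?_)
    ⟨s, hs, ?_⟩ ⟨e, he, ?_⟩ (fun k hk hkc => ?_)
  · exact (toSCC_eq_iff.1 ((List.idxOf_inj (hp.2.2 _)).1 (Nat.succ_injective hab))).1
  · obtain ⟨t, rfl⟩ := List.head?_eq_some_iff.1 hC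
    simp
  · obtain ⟨t, rfl⟩ := List.getLast?_eq_some_iff.1 hD
    have := hpos t.length (by simp)
    simp only [List.getElem_concat_length] at this
    simp [this]
  · obtain ⟨k, rfl⟩ := Nat.exists_eq_add_of_le' hk
    obtain ⟨-, a, b, ha, hb, hab⟩ := List.isChain_iff_getElem.1 hp.1 k hkc
    exact ⟨a, b, hab, by rw [ha, hpos], by rw [hb, hpos]⟩

end SLT2

/-! ### Depth-first search on arrays -/

/-- A digraph on `{0, …, n - 1}` given by `m` edges, the `i`-th of which leads from `src i` to
`dst i`. -/
structure EdgeList where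
  n : ℕ
  m : ℕ
  src : ℕ → ℕ
  dst : ℕ → ℕ
  src_lt : ∀ i < m, src i < n
  dst_lt : ∀ i < m, dst i < n

namespace EdgeList

/-- The edge relation. -/
def Adj (g : EdgeList) (u v : ℕ) : Prop :=
  ∃ i < g.m, g.src i = u ∧ g.dst i = v

/-- Reachability by a directed walk, possibly of length zero. -/
abbrev Reach (g : EdgeList) : ℕ → ℕ → Prop :=
  ReflTransGen g.Adj

/-- All edges turned around. -/
def reverse (g : EdgeList) : EdgeList where
  n := g.n
  m := g.m
  src := g.dst
  dst := g.src
  src_lt := g.dst_lt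
  dst_lt := g.src_lt

theorem reverse_adj {g : EdgeList} {u v : ℕ} : g.reverse.Adj u v ↔ g.Adj v u := by
  simp [Adj, reverse, and_comm]

theorem reverse_reach {g : EdgeList} {u v : ℕ} : g.reverse.Reach u v ↔ g.Reach v u := by
  rw [Reach, Reach, ← reflTransGen_swap]
  have : Function.swap g.reverse.Adj = g.Adj := by
    funext a b
    exact propext reverse_adj
  rw [this]

theorem Adj.lt_right {g : EdgeList} {u v : ℕ} (h : g.Adj u v) : v < g.n := by
  obtain ⟨i, hi, -, rfl⟩ := h
  exact g.dst_lt i hi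

/-- The pointer `h` denotes the last edge with index below `j` that leaves `u`. A pointer to the
edge `i` is the number `i + 1`, and `0` is the null pointer. -/
def PointsTo (g : EdgeList) (u h j : ℕ) : Prop :=
  h ≤ j ∧ (∀ i, h ≤ i → i < j → g.src i ≠ u) ∧ (h ≠ 0 → g.src (h - 1) = u)

/-- Adjacency lists of the first `j` edges: `head u` points to the last edge leaving `u`, and
`next i` to the edge before the `i`-th one that leaves the same vertex. -/
def IsAdjacency (g : EdgeList) (head next : ℕ → ℕ) (j : ℕ) : Prop :=
  (∀ u < g.n, g.PointsTo u (head u) j) ∧ ∀ i < j, g.PointsTo (g.src i) (next i) i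

theorem isAdjacency_zero (g : EdgeList) {head : ℕ → ℕ} (next : ℕ → ℕ)
    (h : ∀ u < g.n, head u = 0) :
    g.IsAdjacency head next 0 :=
  ⟨fun u hu => ⟨by simp [h u hu], by simp, by simp [h u hu]⟩, by simp⟩

theorem IsAdjacency.succ {g : EdgeList} {head next : ℕ → ℕ} {j : ℕ}
    (h : g.IsAdjacency head next j) (hj : j < g.m) :
    g.IsAdjacency (Function.update head (g.src j) (j + 1))
      (Function.update next j (head (g.src j))) (j + 1) := by
  constructor
  · intro u hun
    rw [Function.update_apply]
    split_ifs with hu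
    · exact ⟨le_rfl, by omega, fun _ => hu.symm⟩
    · obtain ⟨h1, h2, h3⟩ := h.1 u hun
      refine ⟨by omega, fun i hi hij => ?_, h3⟩
      rcases (by omega : i < j ∨ i = j) with hij | rfl
      · exact h2 i hi hij
      · exact fun h => hu h.symm
  · intro i hi
    rw [Function.update_apply]
    split_ifs with hij
    · subst hij
      exact h.1 _ (g.src_lt i hj)
    · exact h.2 i (by omega)

/-- The state of a depth-first search that keeps its stack explicitly. -/
structure Dfs where
  /-- pointers to the edges that are still to be scanned -/
  head : ℕ → ℕ
  /-- the number of the search tree that contains a vertex, `0` for vertices not yet visited -/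
  mark : ℕ → ℕ
  /-- the stack; its members are `stk 0, …, stk (sp - 1)` -/
  stk : ℕ → ℕ
  /-- the finished vertices `out cnt, …, out (n - 1)`, the one finished last coming first -/
  out : ℕ → ℕ
  /-- the height of the stack -/
  sp : ℕ
  /-- the number of vertices that are not finished -/
  cnt : ℕ
  /-- the number of possible roots already considered -/
  pos : ℕ
  /-- the number of search trees -/
  c : ℕ

namespace Dfs

/-- The number of vertices not yet visited. -/
def white (g : EdgeList) (d : Dfs) : ℕ :=
  ((Finset.range g.n).filter fun v => d.mark v = 0).card

/-- The number of edges not yet scanned. -/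
def unscanned (g : EdgeList) (d : Dfs) : ℕ :=
  ((Finset.range g.m).filter fun i => i < d.head (g.src i)).card

/-- Every step of the search decreases this number. -/
def measure (g : EdgeList) (d : Dfs) : ℕ :=
  d.unscanned g + 2 * d.white g + d.sp + (g.n - d.pos)

/-- The vertex on the top of the stack is finished. -/
def pop (d : Dfs) : Dfs :=
  { d with
    out := Function.update d.out (d.cnt - 1) (d.stk (d.sp - 1))
    sp := d.sp - 1
    cnt := d.cnt - 1 }

/-- The pointer of `u` advances to `h`. -/
def advance (d : Dfs) (u h : ℕ) : Dfs :=
  { d with head := Function.update d.head u h }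

/-- The new vertex `w` is visited in the current search tree. -/
def pushChild (d : Dfs) (w : ℕ) : Dfs :=
  { d with
    mark := Function.update d.mark w d.c
    stk := Function.update d.stk d.sp w
    sp := d.sp + 1 }

/-- The new vertex `w` becomes the root of a new search tree. -/
def pushRoot (d : Dfs) (w : ℕ) : Dfs :=
  { d with
    mark := Function.update d.mark w (d.c + 1)
    stk := Function.update d.stk d.sp w
    sp := d.sp + 1
    pos := d.pos + 1
    c := d.c + 1 }

/-- A possible root is passed over because it has been visited. -/
def skipRoot (d : Dfs) : Dfs :=
  { d with pos := d.pos + 1 }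

/-- The invariant of a depth-first search that considers the roots in the order
`ord 0, ord 1, …`. -/
structure Inv (g : EdgeList) (ord : ℕ → ℕ) (d : Dfs) : Prop where
  head_le : ∀ u < g.n, d.head u ≤ g.m
  head_src : ∀ u < g.n, d.head u ≠ 0 → g.src (d.head u - 1) = u
  /-- The end of a scanned edge has been visited, in the tree of its source or an earlier one. -/
  scanned : ∀ i < g.m, d.head (g.src i) ≤ i →
    d.mark (g.dst i) ≠ 0 ∧ d.mark (g.dst i) ≤ d.mark (g.src i)
  /-- The unfinished vertices are those on the stack and those not yet visited. -/
  sp_add_white : d.sp + d.white g = d.cnt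
  cnt_le : d.cnt ≤ g.n
  pos_le : d.pos ≤ g.n
  c_add_white : d.c + d.white g ≤ g.n
  mark_le : ∀ v < g.n, d.mark v ≤ d.c
  stk_lt : ∀ p < d.sp, d.stk p < g.n
  mark_stk : ∀ p < d.sp, d.mark (d.stk p) = d.c
  c_pos : 0 < d.sp → 0 < d.c
  stk_reach : ∀ p q, p ≤ q → q < d.sp → g.Reach (d.stk p) (d.stk q)
  out_lt : ∀ j, d.cnt ≤ j → j < g.n → d.out j < g.n
  head_out : ∀ j, d.cnt ≤ j → j < g.n → d.head (d.out j) = 0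
  cover : ∀ v < g.n, d.mark v ≠ 0 →
    (∃ p < d.sp, d.stk p = v) ∨ ∃ j, d.cnt ≤ j ∧ j < g.n ∧ d.out j = v
  /-- If a finished vertex has an edge to a vertex `v` on the stack, then everything finished
  since is reachable from `v`. -/
  stk_reach_out : ∀ p < d.sp, ∀ j, d.cnt ≤ j → j < g.n → g.Adj (d.out j) (d.stk p) →
    ∀ k, d.cnt ≤ k → k ≤ j → g.Reach (d.stk p) (d.out k)
  /-- If a finished vertex has an edge to a vertex `v` that was finished later, then everything
  finished in between is reachable from `v`. -/
  out_reach_out : ∀ i j, d.cnt ≤ i → i < j → j < g.n → g.Adj (d.out j) (d.out i) →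
    ∀ k, i ≤ k → k ≤ j → g.Reach (d.out i) (d.out k)
  seen : ∀ j < d.pos, d.mark (ord j) ≠ 0
  /-- Each search tree has a root, which is preceded in the order by vertices of earlier trees only
  and reaches the whole tree. -/
  root : ∀ k, 1 ≤ k → k ≤ d.c → ∃ i < d.pos, d.mark (ord i) = k ∧
    (∀ j < i, d.mark (ord j) < k) ∧ ∀ v < g.n, d.mark v = k → g.Reach (ord i) v

variable {g : EdgeList} {ord next : ℕ → ℕ} {d : Dfs}

theorem inv_init (hhead : g.IsAdjacency d.head next g.m) (hmark : ∀ v < g.n, d.mark v = 0)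
    (hsp : d.sp = 0) (hcnt : d.cnt = g.n) (hpos : d.pos = 0) (hc : d.c = 0) : d.Inv g ord where
  head_le u hu := (hhead.1 u hu).1
  head_src u hu := (hhead.1 u hu).2.2
  scanned i hi h := absurd rfl ((hhead.1 (g.src i) (g.src_lt i hi)).2.1 i h hi)
  sp_add_white := by
    rw [white, Finset.filter_true_of_mem (by simpa using hmark), Finset.card_range, hsp, hcnt,
      zero_add]
  cnt_le := hcnt.le
  pos_le := by omega
  c_add_white := by
    rw [hc, zero_add]
    exact (Finset.card_filter_le _ _).trans (Finset.card_range _).le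
  mark_le v hv := by simp [hmark v hv]
  stk_lt := by simp [hsp]
  mark_stk := by simp [hsp]
  c_pos := by simp [hsp]
  stk_reach := by simp [hsp]
  out_lt := by omega
  head_out := by omega
  cover v hv h := absurd (hmark v hv) h
  stk_reach_out := by simp [hsp]
  out_reach_out := by omega
  seen := by simp [hpos]
  root := by omega

/-- Visiting a new vertex leaves one unvisited vertex fewer. -/
theorem white_update {w x : ℕ} {d d' : Dfs} (hw : w < g.n) (hd : d.mark w = 0) (hx : x ≠ 0)
    (h : d'.mark = Function.update d.mark w x) : d'.white g + 1 = d.white g := by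
  have : (Finset.range g.n).filter (fun v => d'.mark v = 0) =
      ((Finset.range g.n).filter fun v => d.mark v = 0).erase w := by
    ext v
    by_cases hv : v = w
    · simp [h, hv, hx]
    · simp [h, hv]
  rw [white, this, Finset.card_erase_of_mem (by simp [hw, hd]), white]
  exact Nat.sub_add_cancel (Finset.card_pos.2 ⟨w, by simp [hw, hd]⟩)

theorem Inv.pop (h : d.Inv g ord) (hsp : 0 < d.sp) (hhead : d.head (d.stk (d.sp - 1)) = 0) :
    d.pop.Inv g ord := by
  have hcnt := h.sp_add_white
  have hle := h.cnt_le
  have hnew : ∀ j, d.cnt - 1 ≤ j → (j = d.cnt - 1 ∧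
      Function.update d.out (d.cnt - 1) (d.stk (d.sp - 1)) j = d.stk (d.sp - 1)) ∨
      (d.cnt ≤ j ∧ Function.update d.out (d.cnt - 1) (d.stk (d.sp - 1)) j = d.out j) := by
    intro j hj
    by_cases hj' : j = d.cnt - 1
    · exact .inl ⟨hj', by simp [hj']⟩
    · exact .inr ⟨by omega, by simp [hj']⟩
  refine
    { h with
      sp_add_white := ?_
      cnt_le := ?_
      stk_lt := fun p hp => h.stk_lt p (lt_of_lt_of_le hp (Nat.sub_le _ _))
      mark_stk := fun p hp => h.mark_stk p (lt_of_lt_of_le hp (Nat.sub_le _ _))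
      c_pos := fun _ => h.c_pos hsp
      stk_reach := fun p q hpq hq => h.stk_reach p q hpq (lt_of_lt_of_le hq (Nat.sub_le _ _))
      out_lt := ?_
      head_out := ?_
      cover := ?_
      stk_reach_out := ?_
      out_reach_out := ?_ }
  · change d.sp - 1 + d.white g = d.cnt - 1
    omega
  · change d.cnt - 1 ≤ g.n
    omega
  · intro j hj hjn
    simp only [Dfs.pop] at hj ⊢
    rcases hnew j hj with ⟨-, hj'⟩ | ⟨hj1, hj'⟩
    · rw [hj']
      exact h.stk_lt _ (by omega)
    · exact hj' ▸ h.out_lt j hj1 hjn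
  · intro j hj hjn
    simp only [Dfs.pop] at hj ⊢
    rcases hnew j hj with ⟨-, hj'⟩ | ⟨hj1, hj'⟩
    · rw [hj']
      exact hhead
    · exact hj' ▸ h.head_out j hj1 hjn
  · intro v hv hm
    rcases h.cover v hv hm with ⟨p, hp, rfl⟩ | ⟨j, hj, hjn, rfl⟩
    · by_cases hp' : p = d.sp - 1
      · exact .inr ⟨d.cnt - 1, le_rfl, by omega, by simp [Dfs.pop, hp']⟩
      · exact .inl ⟨p, by simp [Dfs.pop]; omega, rfl⟩
    · exact .inr ⟨j, by simp [Dfs.pop]; omega, hjn, by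
        simp only [Dfs.pop]; rw [Function.update_of_ne (by omega)]⟩
  · intro p hp j hj hjn hadj k hk hkj
    simp only [Dfs.pop] at hp hj hk hadj ⊢
    rcases hnew k hk with ⟨-, hk'⟩ | ⟨hk1, hk'⟩
    · rw [hk']
      exact h.stk_reach p _ (by omega) (by omega)
    · rcases hnew j hj with ⟨hj1, -⟩ | ⟨hj1, hj'⟩
      · omega
      · rw [hj'] at hadj
        exact hk' ▸ h.stk_reach_out p (by omega) j hj1 hjn hadj k hk1 hkj
  · intro i j hi hij hjn hadj k hik hkj
    simp only [Dfs.pop] at hi hadj ⊢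
    rcases hnew j (by omega) with ⟨hj1, -⟩ | ⟨hj1, hj'⟩
    · omega
    rw [hj'] at hadj
    rcases hnew i hi with ⟨hi1, hi'⟩ | ⟨hi1, hi'⟩
    · rcases hnew k (by omega) with ⟨hk1, hk'⟩ | ⟨hk1, hk'⟩
      · rw [hi', hk']
      · rw [hi'] at hadj ⊢
        exact hk' ▸ h.stk_reach_out _ (by omega) j hj1 hjn hadj k hk1 hkj
    · rw [hi'] at hadj ⊢
      rcases hnew k (by omega) with ⟨hk1, hk'⟩ | ⟨hk1, hk'⟩
      · omega
      · exact hk' ▸ h.out_reach_out i j hi1 hij hjn hadj k hik hkj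

theorem Inv.advance (h : d.Inv g ord) {u e : ℕ} (hun : u < g.n) (hu : d.head u = e + 1)
    (hnext : g.PointsTo u (next e) e) (hmark : d.mark (g.dst e) ≠ 0)
    (hle : d.mark (g.dst e) ≤ d.mark u) : (d.advance u (next e)).Inv g ord := by
  have hem := h.head_le u hun
  refine
    { h with
      head_le := ?_
      head_src := ?_
      scanned := ?_
      head_out := ?_ }
  · intro v hv
    simp only [Dfs.advance, Function.update_apply]
    split_ifs
    · have := hnext.1
      omega
    · exact h.head_le v hv
  · intro v hvn
    simp only [Dfs.advance, Function.update_apply]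
    split_ifs with hv
    · exact hv ▸ hnext.2.2
    · exact h.head_src v hvn
  · intro i hi
    simp only [Dfs.advance, Function.update_apply]
    split_ifs with hv
    · intro hni
      rcases lt_trichotomy i e with hie | rfl | hie
      · exact absurd hv (hnext.2.1 i hni hie)
      · exact ⟨hmark, hv ▸ hle⟩
      · exact h.scanned i hi (by rw [hv]; omega)
    · exact h.scanned i hi
  · intro j hj hjn
    have h0 := h.head_out j hj hjn
    simp only [Dfs.advance, Function.update_apply]
    split_ifs with hv
    · rw [hv] at h0
      omega
    · exact h0

theorem unscanned_advance (h : d.Inv g ord) {u e : ℕ} (hun : u < g.n) (hu : d.head u = e + 1)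
    (hnext : g.PointsTo u (next e) e) : (d.advance u (next e)).unscanned g < d.unscanned g := by
  have hem := h.head_le u hun
  have hsrc := h.head_src u hun (by omega)
  rw [hu, Nat.add_sub_cancel] at hsrc
  have hne := hnext.1
  refine Finset.card_lt_card (Finset.ssubset_iff_of_subset ?_ |>.2 ⟨e, ?_, ?_⟩)
  · intro i hi
    simp only [Finset.mem_filter, Dfs.advance, Function.update_apply, Finset.mem_range] at hi ⊢
    refine ⟨hi.1, ?_⟩
    have := hi.2
    split_ifs at this with hv
    · rw [hv]
      omega
    · exact this
  · simp only [Finset.mem_filter, Finset.mem_range, hsrc]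
    omega
  · intro hmem
    have := (Finset.mem_filter.1 hmem).2
    simp only [Dfs.advance, hsrc, Function.update_self] at this
    omega

/-- An edge scanned before leads neither to nor from a vertex that is visited only now. -/
theorem Inv.scanned_update (h : d.Inv g ord) {w x : ℕ} (hw : d.mark w = 0) {i : ℕ}
    (hi : i < g.m) (hs : d.head (g.src i) ≤ i) :
    Function.update d.mark w x (g.dst i) ≠ 0 ∧
      Function.update d.mark w x (g.dst i) ≤ Function.update d.mark w x (g.src i) := by
  obtain ⟨h1, h2⟩ := h.scanned i hi hs
  rw [Function.update_of_ne (fun h' : g.dst i = w => h1 (h' ▸ hw)), Function.update_of_ne]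
  · exact ⟨h1, h2⟩
  · intro h'
    rw [h', hw] at h2
    exact h1 (Nat.le_zero.1 h2)

/-- No edge leads from a finished vertex to an unvisited one. -/
theorem Inv.mark_ne_zero_of_adj_out (h : d.Inv g ord) {j v : ℕ} (hj : d.cnt ≤ j) (hjn : j < g.n)
    (hadj : g.Adj (d.out j) v) : d.mark v ≠ 0 := by
  obtain ⟨i, hi, hsrc, rfl⟩ := hadj
  exact (h.scanned i hi (by rw [hsrc, h.head_out j hj hjn]; exact Nat.zero_le _)).1

theorem Inv.pushChild (h : d.Inv g ord) (hsp : 0 < d.sp) {w : ℕ} (hw : w < g.n)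
    (hmark : d.mark w = 0) (hadj : g.Adj (d.stk (d.sp - 1)) w) : (d.pushChild w).Inv g ord := by
  have hc := h.c_pos hsp
  have hwhite : (d.pushChild w).white g + 1 = d.white g := white_update hw hmark hc.ne' rfl
  have hs := h.sp_add_white
  have hcw := h.c_add_white
  have hne : ∀ {v}, d.mark v ≠ 0 → v ≠ w := fun hv hvw => hv (hvw ▸ hmark)
  have hstk : ∀ p < d.sp + 1, (p = d.sp ∧ Function.update d.stk d.sp w p = w) ∨
      (p < d.sp ∧ Function.update d.stk d.sp w p = d.stk p) := by
    intro p hp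
    by_cases hp' : p = d.sp
    · exact .inl ⟨hp', by simp [hp']⟩
    · exact .inr ⟨by omega, by simp [hp']⟩
  refine
    { h with
      scanned := fun i hi hs => h.scanned_update hmark hi hs
      sp_add_white := ?_
      c_add_white := ?_
      mark_le := ?_
      stk_lt := ?_
      mark_stk := ?_
      c_pos := fun _ => hc
      stk_reach := ?_
      cover := ?_
      stk_reach_out := ?_
      seen := ?_
      root := ?_ }
  · change d.sp + 1 + _ = d.cnt
    omega
  · change d.c + _ ≤ g.n
    omega
  · intro v hv
    simp only [Dfs.pushChild, Function.update_apply]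
    split_ifs
    · exact le_rfl
    · exact h.mark_le v hv
  · intro p hp
    simp only [Dfs.pushChild] at hp ⊢
    rcases hstk p hp with ⟨-, hp'⟩ | ⟨hp, hp'⟩ <;> rw [hp']
    · exact hw
    · exact h.stk_lt p hp
  · intro p hp
    simp only [Dfs.pushChild] at hp ⊢
    rcases hstk p hp with ⟨-, hp'⟩ | ⟨hp, hp'⟩ <;> rw [hp']
    · simp
    · rw [Function.update_of_ne (hne (by rw [h.mark_stk p hp]; omega))]
      exact h.mark_stk p hp
  · intro p q hpq hq
    simp only [Dfs.pushChild] at hq ⊢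
    rcases hstk q hq with ⟨hq1, hq'⟩ | ⟨hq1, hq'⟩ <;>
      rcases hstk p (by omega) with ⟨hp1, hp'⟩ | ⟨hp1, hp'⟩ <;> rw [hq', hp']
    · exact (h.stk_reach p _ (by omega) (by omega)).tail hadj
    · omega
    · exact h.stk_reach p q hpq hq1
  · intro v hv hm
    simp only [Dfs.pushChild, Function.update_apply] at hm ⊢
    split_ifs at hm with hvw
    · exact .inl ⟨d.sp, by omega, by simp [hvw]⟩
    · rcases h.cover v hv hm with ⟨p, hp, rfl⟩ | hj
      · exact .inl ⟨p, by omega, by simp [hp.ne]⟩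
      · exact .inr hj
  · intro p hp j hj hjn hadj' k hk hkj
    simp only [Dfs.pushChild] at hp hj hk hadj' ⊢
    rcases hstk p hp with ⟨-, hp'⟩ | ⟨hp, hp'⟩ <;> rw [hp'] at hadj' ⊢
    · exact absurd hmark (h.mark_ne_zero_of_adj_out hj hjn hadj')
    · exact h.stk_reach_out p hp j hj hjn hadj' k hk hkj
  · intro j hj
    simp only [Dfs.pushChild] at hj ⊢
    rw [Function.update_of_ne (hne (h.seen j hj))]
    exact h.seen j hj
  · intro k hk hkc
    obtain ⟨i, hi, hik, hlt, hreach⟩ := h.root k hk hkc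
    simp only [Dfs.pushChild]
    refine ⟨i, hi, ?_, fun j hj => ?_, fun v hv hvk => ?_⟩
    · rw [Function.update_of_ne (hne (by omega)), hik]
    · rw [Function.update_of_ne (hne (h.seen j (hj.trans hi)))]
      exact hlt j hj
    · rw [Function.update_apply] at hvk
      split_ifs at hvk with hvw
      · rw [hvw]
        exact (hreach _ (h.stk_lt _ (by omega)) ((h.mark_stk _ (by omega)).trans hvk)).tail hadj
      · exact hreach v hv hvk

theorem Inv.pushRoot (h : d.Inv g ord) (hsp : d.sp = 0) (hord : ∀ i < g.n, ord i < g.n)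
    (hpos : d.pos < g.n) (hmark : d.mark (ord d.pos) = 0) :
    (d.pushRoot (ord d.pos)).Inv g ord := by
  have hw := hord _ hpos
  set w := ord d.pos with hwdef
  have hwhite : (d.pushRoot w).white g + 1 = d.white g :=
    white_update hw hmark (Nat.succ_ne_zero _) rfl
  have hs := h.sp_add_white
  have hcw := h.c_add_white
  have hne : ∀ {v}, d.mark v ≠ 0 → v ≠ w := fun hv hvw => hv (hvw ▸ hmark)
  have hstk : ∀ p < d.sp + 1, Function.update d.stk d.sp w p = w := by
    intro p hp
    have : p = d.sp := by omega
    simp [this]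
  refine
    { h with
      scanned := fun i hi hs => h.scanned_update hmark hi hs
      sp_add_white := ?_
      pos_le := hpos
      c_add_white := ?_
      mark_le := ?_
      stk_lt := ?_
      mark_stk := ?_
      c_pos := fun _ => Nat.succ_pos _
      stk_reach := ?_
      cover := ?_
      stk_reach_out := ?_
      seen := ?_
      root := ?_ }
  · change d.sp + 1 + _ = d.cnt
    omega
  · change d.c + 1 + _ ≤ g.n
    omega
  · intro v hv
    simp only [Dfs.pushRoot, Function.update_apply]
    split_ifs
    · exact le_rfl
    · exact (h.mark_le v hv).trans (Nat.le_succ _)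
  · intro p hp
    simp only [Dfs.pushRoot] at hp ⊢
    rw [hstk p hp]
    exact hw
  · intro p hp
    simp only [Dfs.pushRoot] at hp ⊢
    rw [hstk p hp]
    simp
  · intro p q hpq hq
    simp only [Dfs.pushRoot] at hq ⊢
    rw [hstk p (by omega), hstk q hq]
  · intro v hv hm
    simp only [Dfs.pushRoot, Function.update_apply] at hm ⊢
    split_ifs at hm with hvw
    · exact .inl ⟨d.sp, by omega, by simp [hvw]⟩
    · exact .inr ((h.cover v hv hm).resolve_left fun ⟨p, hp, _⟩ => by omega)
  · intro p hp j hj hjn hadj' k hk hkj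
    simp only [Dfs.pushRoot] at hp hj hk hadj' ⊢
    rw [hstk p hp] at hadj'
    exact absurd hmark (h.mark_ne_zero_of_adj_out hj hjn hadj')
  · intro j hj
    simp only [Dfs.pushRoot, Function.update_apply] at hj ⊢
    split_ifs with hjw
    · omega
    · refine h.seen j (lt_of_le_of_ne (Nat.le_of_lt_succ hj) fun hjp => hjw ?_)
      rw [hjp, hwdef]
  · intro k hk hkc
    simp only [Dfs.pushRoot] at hkc ⊢
    rcases (by omega : k ≤ d.c ∨ k = d.c + 1) with hkc | rfl
    · obtain ⟨i, hi, hik, hlt, hreach⟩ := h.root k hk hkc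
      refine ⟨i, by omega, ?_, fun j hj => ?_, fun v hv hvk => ?_⟩
      · rw [Function.update_of_ne (hne (by omega)), hik]
      · rw [Function.update_of_ne (hne (h.seen j (hj.trans hi)))]
        exact hlt j hj
      · rw [Function.update_apply] at hvk
        split_ifs at hvk with hvw
        · omega
        · exact hreach v hv hvk
    · refine ⟨d.pos, by omega, by rw [← hwdef]; simp, fun j hj => ?_, fun v hv hvk => ?_⟩
      · rw [Function.update_of_ne (hne (h.seen j hj))]
        exact Nat.lt_succ_of_le (h.mark_le _ (hord j (hj.trans hpos)))
      · rw [Function.update_apply] at hvk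
        split_ifs at hvk with hvw
        · rw [hvw]
        · have := h.mark_le v hv
          omega

theorem Inv.skipRoot (h : d.Inv g ord) (hpos : d.pos < g.n) (hmark : d.mark (ord d.pos) ≠ 0) :
    d.skipRoot.Inv g ord where
  __ := h
  pos_le := hpos
  seen j hj := by
    simp only [Dfs.skipRoot] at hj ⊢
    rcases (by omega : j < d.pos ∨ j = d.pos) with hj | rfl
    · exact h.seen j hj
    · exact hmark
  root k hk hkc := by
    obtain ⟨i, hi, hroot⟩ := h.root k hk hkc
    exact ⟨i, hi.trans (Nat.lt_succ_self _), hroot⟩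

/-- As long as a vertex is unfinished and the stack is empty, some possible root is left. -/
theorem Inv.pos_lt (h : d.Inv g ord) (hord : ∀ v < g.n, ∃ i < g.n, ord i = v) (hsp : d.sp = 0)
    (hcnt : 0 < d.cnt) : d.pos < g.n := by
  have hs := h.sp_add_white
  obtain ⟨v, hv⟩ := Finset.card_pos.1 (show 0 < d.white g by omega)
  rw [Finset.mem_filter, Finset.mem_range] at hv
  obtain ⟨i, hi, rfl⟩ := hord v hv.1
  by_contra hpos
  exact h.seen i (by omega) hv.2

theorem measure_pop (hsp : 0 < d.sp) : d.pop.measure g < d.measure g := by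
  change d.unscanned g + 2 * d.white g + (d.sp - 1) + (g.n - d.pos) < d.measure g
  unfold measure
  omega

theorem measure_advance (h : d.Inv g ord) {u e : ℕ} (hun : u < g.n) (hu : d.head u = e + 1)
    (hnext : g.PointsTo u (next e) e) : (d.advance u (next e)).measure g < d.measure g := by
  have := unscanned_advance h hun hu hnext
  change (d.advance u (next e)).unscanned g + 2 * d.white g + d.sp + (g.n - d.pos) < d.measure g
  unfold measure
  omega

theorem measure_pushChild (h : d.Inv g ord) (hsp : 0 < d.sp) {w : ℕ} (hw : w < g.n)
    (hmark : d.mark w = 0) : (d.pushChild w).measure g < d.measure g := by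
  have : (d.pushChild w).white g + 1 = d.white g := white_update hw hmark (h.c_pos hsp).ne' rfl
  change d.unscanned g + 2 * (d.pushChild w).white g + (d.sp + 1) + (g.n - d.pos) < d.measure g
  unfold measure
  omega

theorem measure_pushRoot {w : ℕ} (hw : w < g.n) (hmark : d.mark w = 0) :
    (d.pushRoot w).measure g < d.measure g := by
  have : (d.pushRoot w).white g + 1 = d.white g :=
    white_update hw hmark (Nat.succ_ne_zero _) rfl
  change d.unscanned g + 2 * (d.pushRoot w).white g + (d.sp + 1) + (g.n - (d.pos + 1)) <
    d.measure g
  unfold measure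
  omega

theorem measure_skipRoot (hpos : d.pos < g.n) : d.skipRoot.measure g < d.measure g := by
  change d.unscanned g + 2 * d.white g + d.sp + (g.n - (d.pos + 1)) < d.measure g
  unfold measure
  omega

/-- The measure at the start of a search is linear in the size of the graph. -/
theorem measure_le (hsp : d.sp = 0) : d.measure g ≤ g.m + 3 * g.n := by
  have h1 : d.unscanned g ≤ g.m := (Finset.card_filter_le _ _).trans (Finset.card_range _).le
  have h2 : d.white g ≤ g.n := (Finset.card_filter_le _ _).trans (Finset.card_range _).le
  unfold measure
  omega

end Dfs

/-! ### Strongly connected components from two searches -/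

/-- The sequence `ord 0, …, ord (n - 1)` contains all vertices. -/
structure IsOrder (g : EdgeList) (ord : ℕ → ℕ) : Prop where
  lt : ∀ i < g.n, ord i < g.n
  surj : ∀ v < g.n, ∃ i < g.n, ord i = v

/-- What is known after a complete depth-first search with the root order `ord`: the number
`mark v` of the search tree of each vertex, the number `c` of search trees, and the vertices
`out` in the reverse order of finishing. -/
structure IsDfsResult (g : EdgeList) (ord mark out : ℕ → ℕ) (c : ℕ) : Prop where
  mark_pos : ∀ v < g.n, 1 ≤ mark v
  mark_le : ∀ v < g.n, mark v ≤ c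
  c_le : c ≤ g.n
  mark_adj : ∀ u v, g.Adj u v → mark v ≤ mark u
  root : ∀ k, 1 ≤ k → k ≤ c → ∃ i < g.n, mark (ord i) = k ∧
    (∀ j < i, mark (ord j) < k) ∧ ∀ v < g.n, mark v = k → g.Reach (ord i) v
  isOrder_out : g.IsOrder out
  out_reach : ∀ i j, i < j → j < g.n → g.Adj (out j) (out i) →
    ∀ k, i ≤ k → k ≤ j → g.Reach (out i) (out k)

theorem Dfs.Inv.isDfsResult {g : EdgeList} {ord : ℕ → ℕ} {d : Dfs} (h : d.Inv g ord)
    (hcnt : d.cnt = 0) : g.IsDfsResult ord d.mark d.out d.c := by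
  have hs := h.sp_add_white
  have hmark : ∀ v < g.n, d.mark v ≠ 0 := by
    intro v hv hv0
    have : 0 < d.white g := Finset.card_pos.2 ⟨v, by simp [hv, hv0]⟩
    omega
  have hcover : ∀ v < g.n, ∃ j < g.n, d.out j = v := by
    intro v hv
    rcases h.cover v hv (hmark v hv) with ⟨p, hp, -⟩ | ⟨j, -, hj⟩
    · omega
    · exact ⟨j, hj⟩
  refine ⟨fun v hv => Nat.pos_of_ne_zero (hmark v hv), h.mark_le,
    (Nat.le_add_right _ _).trans h.c_add_white, ?_, ?_,
    ⟨fun i hi => h.out_lt i (by omega) hi, hcover⟩,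
    fun i j hij hj hadj k => h.out_reach_out i j (by omega) hij hj hadj k⟩
  · rintro u v ⟨i, hi, rfl, rfl⟩
    obtain ⟨j, hj, hju⟩ := hcover _ (g.src_lt i hi)
    exact (h.scanned i hi (by rw [← hju, h.head_out j (by omega) hj]; exact Nat.zero_le _)).2
  · intro k hk hkc
    obtain ⟨i, hi, hroot⟩ := h.root k hk hkc
    exact ⟨i, hi.trans_le h.pos_le, hroot⟩

/-- The components found by a second search, in the reversed graph and in the reverse finishing
order of the first one, are strongly connected: if `v` lies in the tree with root `r`, then `v`
reaches `r` along vertices that finished no later than `r`. Going back along this walk, the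
vertices reachable from `r` always form an interval of the finishing order that ends in `r` and
contains the part of the walk already treated, since an edge to a vertex that finished later makes
everything in between reachable. -/
theorem IsDfsResult.reach_of_mark_eq {g : EdgeList} {ord₁ mark₁ out₁ mark₂ out₂ : ℕ → ℕ}
    {c₁ c₂ : ℕ} (h₁ : g.IsDfsResult ord₁ mark₁ out₁ c₁)
    (h₂ : g.reverse.IsDfsResult out₁ mark₂ out₂ c₂) {u v : ℕ} (hu : u < g.n) (hv : v < g.n)
    (huv : mark₂ u = mark₂ v) : g.Reach u v := by
  obtain ⟨i, hi, hik, hlt, hreach⟩ := h₂.root (mark₂ u) (h₂.mark_pos u hu) (h₂.mark_le u hu)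
  have hur := reverse_reach.1 (hreach u hu rfl)
  have hvr := reverse_reach.1 (hreach v hv huv.symm)
  refine hur.trans ?_
  have key : ∀ {x}, g.Reach x (out₁ i) → x < g.n → mark₂ u ≤ mark₂ x →
      ∃ J, i ≤ J ∧ J < g.n ∧ (∃ j ≤ J, out₁ j = x) ∧
        ∀ k, i ≤ k → k ≤ J → g.Reach (out₁ i) (out₁ k) := by
    intro x hx
    induction hx using ReflTransGen.head_induction_on with
    | refl =>
      intro _ _
      refine ⟨i, le_rfl, hi, ⟨i, le_rfl, rfl⟩, fun k hik hki => ?_⟩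
      rw [le_antisymm hki hik]
    | @head x y hxy _ ih =>
      intro hxn hx
      obtain ⟨J, hiJ, hJn, ⟨j, hjJ, hjy⟩, hJ⟩ :=
        ih hxy.lt_right (hx.trans (h₂.mark_adj y x (reverse_adj.2 hxy)))
      obtain ⟨l, hl, hlx⟩ := h₁.isOrder_out.surj x hxn
      by_cases hlJ : l ≤ J
      · exact ⟨J, hiJ, hJn, ⟨l, hlJ, hlx⟩, hJ⟩
      · refine ⟨l, by omega, hl, ⟨l, le_rfl, hlx⟩, fun k hik hkl => ?_⟩
        by_cases hkJ : k ≤ J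
        · exact hJ k hik hkJ
        · have hij : i ≤ j := by
            by_contra hji
            have h3 := hlt j (by omega)
            have h4 := h₂.mark_adj y x (reverse_adj.2 hxy)
            rw [hjy] at h3
            omega
          exact (hJ j hij hjJ).trans (h₁.out_reach j l (by omega) hl (by rwa [hjy, hlx]) k
            (by omega) hkl)
  obtain ⟨J, hiJ, hJn, ⟨j, hjJ, hjv⟩, hJ⟩ := key hvr hv huv.le
  rw [← hjv]
  refine hJ j ?_ hjJ
  by_contra hji
  have h3 := hlt j (by omega)
  rw [hjv] at h3
  omega

end EdgeList

/-! ### Reasoning about the random-access machine -/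

namespace RAM

/-- Within `T` steps the program reaches a halting state with the property `Q`. -/
def Runs (W : ℕ) (P : Prog) (s : State) (T : ℕ) (Q : State → Prop) : Prop :=
  ∃ (t : ℕ) (s' : State), Exec W P s t s' ∧ t ≤ T ∧ Q s'

theorem Runs.mono {W : ℕ} {P : Prog} {s : State} {T T' : ℕ} {Q Q' : State → Prop}
    (h : Runs W P s T Q) (hT : T ≤ T') (hQ : ∀ s', Q s' → Q' s') : Runs W P s T' Q' := by
  obtain ⟨t, s', hP, ht, hs'⟩ := h
  exact ⟨t, s', hP, ht.trans hT, hQ s' hs'⟩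

theorem Runs.seq {W : ℕ} {P P' : Prog} {s : State} {T T' : ℕ} {Q Q' : State → Prop}
    (h : Runs W P s T Q) (h' : ∀ s', Q s' → Runs W P' s' T' Q') :
    Runs W (.seq P P') s (T + T') Q' := by
  obtain ⟨t, s', hP, ht, hs'⟩ := h
  obtain ⟨t', s'', hP', ht', hs''⟩ := h' s' hs'
  exact ⟨t + t', s'', .seq hP hP', Nat.add_le_add ht ht', hs''⟩

/-- The weakest precondition of a program without loops. -/
def Prog.wp (W : ℕ) : Prog → (State → Prop) → State → Prop
  | .skip, Q, s => Q s
  | .move r a, Q, s => a.val s ≤ W ∧ Q (s.setReg r (a.val s))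
  | .add r a b, Q, s => a.val s + b.val s ≤ W ∧ Q (s.setReg r (a.val s + b.val s))
  | .sub r a b, Q, s => a.val s - b.val s ≤ W ∧ Q (s.setReg r (a.val s - b.val s))
  | .load r k a, Q, s => s.mem k (a.val s) ≤ W ∧ Q (s.setReg r (s.mem k (a.val s)))
  | .store k a b, Q, s => b.val s ≤ W ∧ Q (s.setMem k (a.val s) (b.val s))
  | .seq P P', Q, s => P.wp W (P'.wp W Q) s
  | .ite b P P', Q, s => (b.Holds s → P.wp W Q s) ∧ (¬ b.Holds s → P'.wp W Q s)
  | .loop _ _, _, _ => False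

/-- A bound for the number of steps of a program without loops. -/
def Prog.cost : Prog → ℕ
  | .seq P P' => P.cost + P'.cost
  | .ite _ P P' => 1 + (P.cost + P'.cost)
  | _ => 1

theorem runs_of_wp {W : ℕ} {P : Prog} {Q : State → Prop} {s : State} (h : P.wp W Q s) :
    Runs W P s P.cost Q := by
  induction P generalizing Q s with
  | skip => exact ⟨1, s, .skip s, le_rfl, h⟩
  | move r a => exact ⟨1, _, .move s r a h.1, le_rfl, h.2⟩
  | add r a b => exact ⟨1, _, .add s r a b h.1, le_rfl, h.2⟩
  | sub r a b => exact ⟨1, _, .sub s r a b h.1, le_rfl, h.2⟩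
  | load r k a => exact ⟨1, _, .load s r k a h.1, le_rfl, h.2⟩
  | store k a b => exact ⟨1, _, .store s k a b h.1, le_rfl, h.2⟩
  | seq P P' ih ih' => exact (ih h).seq fun s' hs' => ih' hs'
  | ite b P P' ih ih' =>
    by_cases hb : b.Holds s
    · obtain ⟨t, s', hP, ht, hs'⟩ := ih (h.1 hb)
      exact ⟨1 + t, s', .ite_true hb hP, by simp only [Prog.cost]; omega, hs'⟩
    · obtain ⟨t, s', hP, ht, hs'⟩ := ih' (h.2 hb)
      exact ⟨1 + t, s', .ite_false hb hP, by simp only [Prog.cost]; omega, hs'⟩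
  | loop b P => exact h.elim

/-- A loop whose passes decrease `μ` and take at most `K` steps each. -/
theorem runs_loop {W : ℕ} {b : Test} {P : Prog} (Inv : State → Prop) (μ : State → ℕ) (K : ℕ)
    (hstep : ∀ s, Inv s → b.Holds s → Runs W P s K fun s' => Inv s' ∧ μ s' < μ s)
    {s : State} (hs : Inv s) :
    Runs W (.loop b P) s ((K + 1) * μ s + 1) fun s' => Inv s' ∧ ¬ b.Holds s' := by
  induction hμ : μ s using Nat.strong_induction_on generalizing s with
  | _ N ih =>
    by_cases hb : b.Holds s
    · obtain ⟨t, s', hP, ht, hs', hlt⟩ := hstep s hs hb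
      obtain ⟨t', s'', hP', ht', hs''⟩ := ih (μ s') (hμ ▸ hlt) hs' rfl
      refine ⟨1 + t + t', s'', .loop_step hb hP hP', ?_, hs''⟩
      have := Nat.mul_le_mul_left (K + 1) (show μ s' + 1 ≤ N by omega)
      rw [Nat.mul_add] at this
      omega
    · exact ⟨1, s, .loop_exit hb, by omega, hs, hb⟩

/-- The register `r` counts from `0` up to the content of the register `N`. -/
def forLoop (r N : ℕ) (P : Prog) : Prog :=
  .seq (.move r (.lit 0))
    (.loop (.lt (.reg r) (.reg N)) (.seq P (.add r (.reg r) (.lit 1))))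

@[simp] theorem State.setReg_reg (s : State) (r v q : ℕ) :
    (s.setReg r v).reg q = if q = r then v else s.reg q :=
  Function.update_apply ..

@[simp] theorem State.setReg_mem (s : State) (r v : ℕ) : (s.setReg r v).mem = s.mem := rfl

@[simp] theorem State.setMem_reg (s : State) (k i v : ℕ) : (s.setMem k i v).reg = s.reg := rfl

@[simp] theorem State.setMem_mem (s : State) (k i v q : ℕ) :
    (s.setMem k i v).mem q = if q = k then Function.update (s.mem k) i v else s.mem q :=
  Function.update_apply ..

theorem runs_forLoop {W r N n : ℕ} {P : Prog} (Inv : ℕ → State → Prop) (hrN : N ≠ r)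
    (hn : n ≤ W)
    (hstep : ∀ i s, i < n → s.reg r = i → Inv i s → P.wp W (fun s' =>
      s'.reg r = i ∧ s'.reg N = s.reg N ∧ Inv (i + 1) (s'.setReg r (i + 1))) s)
    {s : State} (hN : s.reg N = n) (h0 : Inv 0 (s.setReg r 0)) :
    Runs W (forLoop r N P) s ((P.cost + 2) * n + 2) (Inv n) := by
  have hinit : Runs W (.move r (.lit 0)) s 1 fun s' => s'.reg r = 0 ∧ s'.reg N = n ∧ Inv 0 s' :=
    ⟨1, _, .move s r _ (Nat.zero_le _), le_rfl, by simp [Arg.val], by simp [hrN, hN], h0⟩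
  refine Runs.mono (hinit.seq fun s' hs' => ((runs_loop
    (fun s => s.reg r ≤ n ∧ s.reg N = n ∧ Inv (s.reg r) s) (fun s => n - s.reg r) (P.cost + 1)
    ?_ ⟨by omega, hs'.2.1, hs'.1 ▸ hs'.2.2⟩).mono (T' := (P.cost + 2) * n + 1) ?_ ?_))
    (by omega) (fun _ h => h)
  · rintro s ⟨-, hN, hI⟩ hb
    have hlt : s.reg r < n := hN ▸ hb
    refine (runs_of_wp (hstep _ s hlt rfl hI)).seq fun s' ⟨hr, hN', hI'⟩ =>
      ⟨1, _, .add s' r _ _ ?_, le_rfl, ?_⟩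
    · simp only [Arg.val]
      omega
    · simp only [Arg.val, hr, State.setReg_reg, hrN, if_false, if_true]
      exact ⟨⟨by omega, hN'.trans hN, hI'⟩, by omega⟩
  · rw [hs'.1, Nat.sub_zero]
  · rintro s ⟨⟨hle, hN, hI⟩, hb⟩
    have : ¬ s.reg r < s.reg N := hb
    rwa [show s.reg r = n by omega] at hI

/-- The registers and the arrays with numbers below `4`, which hold the input, agree. -/
def Intact (s₀ s : State) : Prop :=
  (∀ r < 4, s.reg r = s₀.reg r) ∧ ∀ k < 4, s.mem k = s₀.mem k

theorem intact_setReg {s₀ s : State} {r : ℕ} (v : ℕ) (hr : 4 ≤ r) :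
    Intact s₀ (s.setReg r v) ↔ Intact s₀ s := by
  refine and_congr (forall₂_congr fun q hq => ?_) Iff.rfl
  rw [State.setReg_reg, if_neg (by omega)]

theorem intact_setMem {s₀ s : State} {k : ℕ} (i v : ℕ) (hk : 4 ≤ k) :
    Intact s₀ (s.setMem k i v) ↔ Intact s₀ s := by
  refine and_congr Iff.rfl (forall₂_congr fun q hq => ?_)
  rw [State.setMem_mem, if_neg (by omega)]

end RAM

/-! ### The program for the depth-first search -/

namespace RAM

/-- One cell of the initialization: the root order is copied from array `9` to array `4`, and the
pointers in array `5` and the marks in array `7` are cleared. -/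
def resetBody : Prog :=
  .seq (.load 9 9 (.reg 8)) <| .seq (.store 4 (.reg 8) (.reg 9)) <|
  .seq (.store 5 (.reg 8) (.lit 0)) (.store 7 (.reg 8) (.lit 0))

/-- One edge is put in front of the adjacency list of its source, which is read from array `a`. -/
def linkBody (a : ℕ) : Prog :=
  .seq (.load 9 a (.reg 8)) <| .seq (.load 10 5 (.reg 9)) <|
  .seq (.store 6 (.reg 8) (.reg 10)) <| .seq (.add 10 (.reg 8) (.lit 1)) <|
  .store 5 (.reg 9) (.reg 10)

/-- One step of the search with an empty stack: the next possible root is considered. -/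
def rootStep : Prog :=
  .seq (.load 9 4 (.reg 6)) <| .seq (.add 6 (.reg 6) (.lit 1)) <|
  .seq (.load 10 7 (.reg 9)) <|
  .ite (.eq (.reg 10) (.lit 0))
    (.seq (.add 7 (.reg 7) (.lit 1)) <| .seq (.store 7 (.reg 9) (.reg 7)) <|
      .seq (.store 8 (.reg 4) (.reg 9)) (.add 4 (.reg 4) (.lit 1)))
    .skip

/-- One step of the search with a nonempty stack: the top is finished if its adjacency list is
exhausted; otherwise the next edge of the list, with its end in array `b`, is scanned. -/
def stackStep (b : ℕ) : Prog :=
  .seq (.sub 10 (.reg 4) (.lit 1)) <| .seq (.load 9 8 (.reg 10)) <|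
  .seq (.load 11 5 (.reg 9)) <|
  .ite (.eq (.reg 11) (.lit 0))
    (.seq (.move 4 (.reg 10)) <| .seq (.sub 5 (.reg 5) (.lit 1)) <|
      .store 9 (.reg 5) (.reg 9))
    (.seq (.sub 11 (.reg 11) (.lit 1)) <| .seq (.load 12 6 (.reg 11)) <|
      .seq (.store 5 (.reg 9) (.reg 12)) <| .seq (.load 9 b (.reg 11)) <|
      .seq (.load 12 7 (.reg 9)) <|
      .ite (.eq (.reg 12) (.lit 0))
        (.seq (.store 7 (.reg 9) (.reg 7)) <| .seq (.store 8 (.reg 4) (.reg 9)) <|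
          .add 4 (.reg 4) (.lit 1))
        .skip)

/-- One step of the search. -/
def searchStep (b : ℕ) : Prog :=
  .ite (.eq (.reg 4) (.lit 0)) rootStep (stackStep b)

/-- A complete depth-first search in the graph whose edges lead from array `a` to array `b`, with
the root order in array `9`, which is overwritten by the reverse finishing order. The pointers of
the adjacency lists are kept in the arrays `5` and `6`, the stack in array `8`, the tree numbers
are left in array `7` and the number of trees in register `7`; the registers from `8` on are
scratch. -/
def search (a b : ℕ) : Prog :=
  .seq (forLoop 8 0 resetBody) <| .seq (forLoop 8 2 (linkBody a)) <|
  .seq (.seq (.move 4 (.lit 0)) <| .seq (.move 5 (.reg 0)) <|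
    .seq (.move 6 (.lit 0)) (.move 7 (.lit 0))) <|
  .loop (.lt (.lit 0) (.reg 5)) (searchStep b)

/-- The state of the search that the machine holds. -/
def dfsOf (s : State) : EdgeList.Dfs where
  head := s.mem 5
  mark := s.mem 7
  stk := s.mem 8
  out := s.mem 9
  sp := s.reg 4
  cnt := s.reg 5
  pos := s.reg 6
  c := s.reg 7

/-- The invariant of the main loop of `search`. -/
structure SearchInv (g : EdgeList) (s₀ : State) (ord : ℕ → ℕ) (s : State) : Prop where
  intact : Intact s₀ s
  ord_eq : ∀ i < g.n, s.mem 4 i = ord i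
  next : ∀ i < g.m, g.PointsTo (g.src i) (s.mem 6 i) i
  inv : (dfsOf s).Inv g ord

variable {g : EdgeList} {s₀ : State} {ord : ℕ → ℕ} {W : ℕ}

/-- It suffices to recognize the new state of the machine as the result `d` of a search step. -/
theorem SearchInv.of_dfsOf_eq {s s' : State} {d : EdgeList.Dfs} (hs : SearchInv g s₀ ord s)
    (hint : Intact s₀ s') (h4 : s'.mem 4 = s.mem 4) (h6 : s'.mem 6 = s.mem 6)
    (hd : dfsOf s' = d) (hinv : d.Inv g ord) (hlt : d.measure g < (dfsOf s).measure g) :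
    SearchInv g s₀ ord s' ∧ (dfsOf s').measure g < (dfsOf s).measure g :=
  ⟨⟨hint, by rw [h4]; exact hs.ord_eq, by rw [h6]; exact hs.next, hd ▸ hinv⟩, hd ▸ hlt⟩

/-- With an empty stack, the next possible root is pushed or skipped. -/
theorem wp_rootStep (hord : g.IsOrder ord) (hW : g.n + 1 ≤ W) {s : State}
    (hs : SearchInv g s₀ ord s) (hsp : s.reg 4 = 0) (hcnt : 0 < s.reg 5) :
    rootStep.wp W (fun s' => SearchInv g s₀ ord s' ∧
      (dfsOf s').measure g < (dfsOf s).measure g) s := by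
  have hint := hs.intact
  have hinv := hs.inv
  have hpos : s.reg 6 < g.n := hinv.pos_lt hord.surj hsp hcnt
  have hw : ord (s.reg 6) < g.n := hord.lt _ hpos
  have hmle : s.mem 7 (ord (s.reg 6)) ≤ s.reg 7 := hinv.mark_le _ hw
  have hcle : s.reg 7 ≤ g.n := (Nat.le_add_right _ _).trans hinv.c_add_white
  simp only [rootStep, Prog.wp, Arg.val, Test.Holds, State.setReg_reg, State.setReg_mem,
    State.setMem_reg, hs.ord_eq _ hpos]
  norm_num
  refine ⟨by omega, by omega, by omega, fun hm => ?_, fun hm => ?_⟩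
  · have hpush := hinv.pushRoot hsp hord.lt hpos hm
    have hc : s.reg 7 + 1 ≤ g.n := (Nat.le_add_right _ _).trans hpush.c_add_white
    refine ⟨by omega, by omega, by omega, hs.of_dfsOf_eq
      (d := (dfsOf s).pushRoot (ord (s.reg 6))) ?_ ?_ ?_ ?_ hpush
      (EdgeList.Dfs.measure_pushRoot hw hm)⟩
    · simpa [intact_setReg, intact_setMem] using hint
    all_goals simp [dfsOf, EdgeList.Dfs.pushRoot]
  · refine hs.of_dfsOf_eq (d := (dfsOf s).skipRoot) ?_ ?_ ?_ ?_ (hinv.skipRoot hpos hm)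
      (EdgeList.Dfs.measure_skipRoot hpos)
    · simpa [intact_setReg, intact_setMem] using hint
    all_goals simp [dfsOf, EdgeList.Dfs.skipRoot]

/-- With a nonempty stack, the top is popped or its pointer advances, in the latter case after the
end of the scanned edge has been pushed if it is new. -/
theorem wp_stackStep {b : ℕ} (hb : b < 4) (hdst : s₀.mem b = g.dst) (hW : g.n + g.m + 1 ≤ W)
    {s : State} (hs : SearchInv g s₀ ord s) (hsp : s.reg 4 ≠ 0) :
    (stackStep b).wp W (fun s' => SearchInv g s₀ ord s' ∧
      (dfsOf s').measure g < (dfsOf s).measure g) s := by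
  have hint := hs.intact
  have hinv := hs.inv
  have hmemb : s.mem b = g.dst := (hint.2 b hb).trans hdst
  have hb5 : b ≠ 5 := by omega
  have hspn : s.reg 4 + _ = s.reg 5 := hinv.sp_add_white
  have hcn : s.reg 5 ≤ g.n := hinv.cnt_le
  have hu : s.mem 8 (s.reg 4 - 1) < g.n := hinv.stk_lt _ (show _ < s.reg 4 by omega)
  have hh : s.mem 5 (s.mem 8 (s.reg 4 - 1)) ≤ g.m := hinv.head_le _ hu
  have hcle : s.reg 7 ≤ g.n := (Nat.le_add_right _ _).trans hinv.c_add_white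
  set u := s.mem 8 (s.reg 4 - 1) with hudef
  simp only [stackStep, Prog.wp, Arg.val, Test.Holds, State.setReg_reg, State.setReg_mem,
    State.setMem_reg, State.setMem_mem, if_neg hb5, hmemb]
  norm_num [← hudef]
  refine ⟨by omega, by omega, by omega, fun h0 => ⟨by omega, by omega, by omega, ?_⟩,
    fun h0 => ?_⟩
  · refine hs.of_dfsOf_eq (d := (dfsOf s).pop) ?_ ?_ ?_ ?_
      (hinv.pop (Nat.pos_of_ne_zero hsp) h0)
      (EdgeList.Dfs.measure_pop (Nat.pos_of_ne_zero hsp))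
    · simpa [intact_setReg, intact_setMem] using hint
    all_goals simp [dfsOf, EdgeList.Dfs.pop, ← hudef]
  obtain ⟨e, he⟩ := Nat.exists_eq_succ_of_ne_zero h0
  have he' : s.mem 5 u - 1 = e := by omega
  have hem : e < g.m := by omega
  have hsrc : g.src e = u := he' ▸ hinv.head_src u hu h0
  have hnext : g.PointsTo u (s.mem 6 e) e := hsrc ▸ hs.next e hem
  have hdn := g.dst_lt e hem
  have hml : s.mem 7 (g.dst e) ≤ s.reg 7 := hinv.mark_le _ hdn
  have hnl := hnext.1
  have hmu : s.mem 7 u = s.reg 7 := hinv.mark_stk _ (show _ < s.reg 4 by omega)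
  have hadj : g.Adj u (g.dst e) := ⟨e, hem, hsrc, rfl⟩
  rw [he']
  refine ⟨by omega, by omega, by omega, by omega, fun hm => ?_, fun hm => ?_⟩
  · have hpush := hinv.pushChild (Nat.pos_of_ne_zero hsp) hdn hm hadj
    have hspp : s.reg 4 + 1 + _ = s.reg 5 := hpush.sp_add_white
    have hc : 0 < s.reg 7 := hinv.c_pos (Nat.pos_of_ne_zero hsp)
    have hne : u ≠ g.dst e := by
      intro h
      rw [← h, hmu] at hm
      exact hc.ne' hm
    -- The program advances the pointer before it pushes, but the two updates commute, and the
    -- invariant wants the end of a scanned edge to be visited.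
    refine ⟨by omega, by omega, by omega, hs.of_dfsOf_eq
      (d := ((dfsOf s).pushChild (g.dst e)).advance u (s.mem 6 e)) ?_ ?_ ?_ ?_
      (hpush.advance hu he hnext ?_ ?_)
      ((EdgeList.Dfs.measure_advance hpush hu he hnext).trans
        (EdgeList.Dfs.measure_pushChild hinv (Nat.pos_of_ne_zero hsp) hdn hm))⟩
    · simpa [intact_setReg, intact_setMem] using hint
    · simp
    · simp
    · simp [dfsOf, EdgeList.Dfs.advance, EdgeList.Dfs.pushChild]
    · simpa [EdgeList.Dfs.pushChild, dfsOf] using hc.ne'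
    · simp [EdgeList.Dfs.pushChild, hne, dfsOf, hmu]
  · refine hs.of_dfsOf_eq (d := (dfsOf s).advance u (s.mem 6 e)) ?_ ?_ ?_ ?_
      (hinv.advance hu he hnext hm (hml.trans hmu.ge))
      (EdgeList.Dfs.measure_advance hinv hu he hnext)
    · simpa [intact_setReg, intact_setMem] using hint
    all_goals simp [dfsOf, EdgeList.Dfs.advance]

theorem runs_search {a b : ℕ} (ha : a < 4) (hb : b < 4) (hn : s₀.reg 0 = g.n)
    (hm : s₀.reg 2 = g.m) (hsrc : s₀.mem a = g.src) (hdst : s₀.mem b = g.dst)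
    (hW : g.n + g.m + 1 ≤ W) {s : State} (hs : Intact s₀ s) (hord : g.IsOrder (s.mem 9)) :
    Runs W (search a b) s (200 * (g.n + g.m + 1)) fun s' => Intact s₀ s' ∧
      g.IsDfsResult (s.mem 9) (s'.mem 7) (s'.mem 9) (s'.reg 7) := by
  set ord := s.mem 9 with hord_def
  have hreset : Runs W (forLoop 8 0 resetBody) s ((resetBody.cost + 2) * g.n + 2) fun s' =>
      Intact s₀ s' ∧ (∀ i < g.n, s'.mem 4 i = ord i) ∧ (∀ i < g.n, s'.mem 5 i = 0) ∧
        ∀ i < g.n, s'.mem 7 i = 0 := by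
    refine (runs_forLoop (fun j s' => Intact s₀ s' ∧ s'.mem 9 = ord ∧
      (∀ i < j, s'.mem 4 i = ord i) ∧ (∀ i < j, s'.mem 5 i = 0) ∧ ∀ i < j, s'.mem 7 i = 0)
      (by decide) (by omega) ?_ ((hs.1 0 (by decide)).trans hn) ?_).mono le_rfl
      fun s' h => ⟨h.1, h.2.2⟩
    · rintro i s' hi hr ⟨h1, h9, h4, h5, h7⟩
      have := hord.lt i hi
      simp only [resetBody, Prog.wp, Arg.val, State.setReg_reg, State.setReg_mem,
        State.setMem_reg, State.setMem_mem, hr]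
      norm_num [hr, h9]
      refine ⟨by omega, ?_, ?_, ?_, ?_⟩
      · simpa [intact_setReg, intact_setMem] using h1
      all_goals
        intro k hk
        rw [Function.update_apply]
        split_ifs with hki
        · simp [hki]
      · exact h4 k (by omega)
      · exact h5 k (by omega)
      · exact h7 k (by omega)
    · simpa [intact_setReg] using ⟨hs, hord_def.symm⟩
  have hlink : ∀ s, (Intact s₀ s ∧ (∀ i < g.n, s.mem 4 i = ord i) ∧
      (∀ i < g.n, s.mem 5 i = 0) ∧ ∀ i < g.n, s.mem 7 i = 0) →
      Runs W (forLoop 8 2 (linkBody a)) s (((linkBody a).cost + 2) * g.m + 2) fun s' =>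
        Intact s₀ s' ∧ (∀ i < g.n, s'.mem 4 i = ord i) ∧ (∀ i < g.n, s'.mem 7 i = 0) ∧
          g.IsAdjacency (s'.mem 5) (s'.mem 6) g.m := by
    rintro s ⟨h1, h4, h5, h7⟩
    refine runs_forLoop (fun j s' => Intact s₀ s' ∧ (∀ i < g.n, s'.mem 4 i = ord i) ∧
      (∀ i < g.n, s'.mem 7 i = 0) ∧ g.IsAdjacency (s'.mem 5) (s'.mem 6) j)
      (by decide) (by omega) ?_ ((h1.1 2 (by decide)).trans hm) ?_
    · rintro i s' hi hr ⟨h1, h4, h7, hadj⟩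
      have hsi := g.src_lt i hi
      have hhd := (hadj.1 _ hsi).1
      have hmem : s'.mem a = g.src := (h1.2 a ha).trans hsrc
      simp only [linkBody, Prog.wp, Arg.val, State.setReg_reg, State.setReg_mem,
        State.setMem_reg, State.setMem_mem, hr, hmem]
      norm_num [hr]
      refine ⟨by omega, by omega, by omega, ?_, h4, h7, hadj.succ hi⟩
      simpa [intact_setReg, intact_setMem] using h1
    · simpa [intact_setReg] using ⟨h1, h4, h7, g.isAdjacency_zero _ h5⟩
  have hstart : ∀ s, (Intact s₀ s ∧ (∀ i < g.n, s.mem 4 i = ord i) ∧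
      (∀ i < g.n, s.mem 7 i = 0) ∧ g.IsAdjacency (s.mem 5) (s.mem 6) g.m) →
      Runs W (.seq (.move 4 (.lit 0)) <| .seq (.move 5 (.reg 0)) <|
        .seq (.move 6 (.lit 0)) (.move 7 (.lit 0))) s 4 fun s' =>
        SearchInv g s₀ ord s' ∧ s'.reg 4 = 0 := by
    rintro s ⟨h1, h4, h7, hadj⟩
    refine runs_of_wp ?_
    have hn' : s.reg 0 = g.n := (h1.1 0 (by decide)).trans hn
    simp only [Prog.wp, Arg.val, State.setReg_reg]
    norm_num
    refine ⟨by omega, ?_, h4, hadj.2, ?_⟩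
    · simpa [intact_setReg] using h1
    · exact EdgeList.Dfs.inv_init hadj h7 (by simp [dfsOf]) (by simp [dfsOf, hn'])
        (by simp [dfsOf]) (by simp [dfsOf])
  have hloop : ∀ s, SearchInv g s₀ ord s ∧ s.reg 4 = 0 →
      Runs W (.loop (.lt (.lit 0) (.reg 5)) (searchStep b)) s
        (((searchStep b).cost + 1) * (g.m + 3 * g.n) + 1) fun s' => Intact s₀ s' ∧
        g.IsDfsResult ord (s'.mem 7) (s'.mem 9) (s'.reg 7) := by
    rintro s ⟨hinv, hsp⟩
    refine (runs_loop (b := .lt (.lit 0) (.reg 5)) (SearchInv g s₀ ord)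
      (fun s => (dfsOf s).measure g) (searchStep b).cost
      (fun s hs (hcnt : 0 < s.reg 5) => runs_of_wp ⟨fun h => wp_rootStep hord (by omega) hs h hcnt,
        fun h => wp_stackStep hb hdst hW hs h⟩) hinv).mono ?_ fun s' ⟨hs', hcnt⟩ =>
        ⟨hs'.intact, hs'.inv.isDfsResult ?_⟩
    · exact Nat.add_le_add_right (Nat.mul_le_mul_left _ (EdgeList.Dfs.measure_le hsp)) _
    · exact Nat.eq_zero_of_not_pos hcnt
  refine (hreset.seq fun s h => (hlink s h).seq fun s h => (hstart s h).seq hloop).mono ?_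
    fun _ h => h
  simp only [searchStep, rootStep, stackStep, resetBody, linkBody, Prog.cost]
  omega

end RAM

/-! ### The program for the pangram problem -/

namespace RAM

/-- The components with an edge into the next component are flagged in array `10`. -/
def hitBody : Prog :=
  .seq (.load 9 1 (.reg 8)) <| .seq (.load 9 7 (.reg 9)) <|
  .seq (.load 10 2 (.reg 8)) <| .seq (.load 10 7 (.reg 10)) <|
  .seq (.add 11 (.reg 9) (.lit 1)) <|
  .ite (.eq (.reg 10) (.reg 11)) (.store 10 (.reg 9) (.lit 1)) .skip

/-- Register `13` is set to `0` if a component, counted from `1`, is not flagged. -/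
def levelBody : Prog :=
  .ite (.eq (.reg 8) (.lit 0)) .skip <|
  .seq (.load 9 10 (.reg 8)) <|
  .ite (.eq (.reg 9) (.lit 1)) .skip (.move 13 (.lit 0))

/-- Register `f` tells whether array `k`, whose length is in register `N`, contains a letter of
the component `t`. -/
def existsLoop (f N k : ℕ) (t : Arg) : Prog :=
  .seq (.move f (.lit 0)) <| forLoop 8 N <|
  .seq (.load 9 k (.reg 8)) <| .seq (.load 9 7 (.reg 9)) <|
  .ite (.eq (.reg 9) t) (.move f (.lit 1)) .skip

/-- The answer is put together from the registers `13`, `14` and `15`. -/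
def answer : Prog :=
  .ite (.eq (.reg 13) (.lit 1))
    (.ite (.eq (.reg 14) (.lit 1))
      (.ite (.eq (.reg 15) (.lit 1)) (.move 0 (.lit 1)) (.move 0 (.lit 0)))
      (.move 0 (.lit 0)))
    (.move 0 (.lit 0))

/-- Two searches number the strongly connected components in a topological order; it remains to
test whether consecutive components are joined by edges, whether the first component contains a
letter of `S`, and whether the last one contains a letter of `E`. -/
def pangramProg : Prog :=
  .seq (forLoop 8 0 (.store 9 (.reg 8) (.reg 8))) <|
  .seq (search 1 2) <| .seq (search 2 1) <|
  .seq (forLoop 8 0 (.store 10 (.reg 8) (.lit 0))) <|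
  .seq (forLoop 8 2 hitBody) <|
  .seq (.seq (.move 13 (.lit 1)) (forLoop 8 7 levelBody)) <|
  .seq (existsLoop 14 1 0 (.lit 1)) <| .seq (existsLoop 15 3 3 (.reg 7)) answer

/-- The component numbers `mark` and the number `c` of components are available. -/
def Marked (s₀ : State) (mark : ℕ → ℕ) (c : ℕ) (s : State) : Prop :=
  Intact s₀ s ∧ s.mem 7 = mark ∧ s.reg 7 = c

variable {g : EdgeList} {s₀ : State} {mark : ℕ → ℕ} {c W : ℕ}

theorem runs_clear (hn : s₀.reg 0 = g.n) (hW : g.n ≤ W) {s : State} (hs : Marked s₀ mark c s) :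
    Runs W (forLoop 8 0 (.store 10 (.reg 8) (.lit 0))) s (3 * g.n + 2) fun s' =>
      Marked s₀ mark c s' ∧ ∀ k < g.n, s'.mem 10 k = 0 := by
  refine runs_forLoop (fun j s' => Marked s₀ mark c s' ∧ ∀ k < j, s'.mem 10 k = 0)
    (by decide) hW ?_ ((hs.1.1 0 (by decide)).trans hn) ?_
  · rintro i s hi hr ⟨⟨h1, h7, hc⟩, h⟩
    simp only [Prog.wp, Arg.val, hr]
    refine ⟨Nat.zero_le _, hr, rfl, ⟨?_, by simpa using h7, by simpa using hc⟩, ?_⟩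
    · simpa [intact_setReg, intact_setMem] using h1
    · intro k hk
      simp only [State.setReg_mem, State.setMem_mem, if_true, Function.update_apply]
      split_ifs with hki
      · rfl
      · exact h k (by omega)
  · exact ⟨⟨by simpa [intact_setReg] using hs.1, hs.2.1, by simpa using hs.2.2⟩, by simp⟩

theorem runs_hit (hm : s₀.reg 2 = g.m) (hsrc : s₀.mem 1 = g.src) (hdst : s₀.mem 2 = g.dst)
    (hmark : ∀ v < g.n, mark v ≤ g.n) (hW : g.n + g.m + 1 ≤ W) {s : State}
    (hs : Marked s₀ mark c s) (h0 : ∀ k < g.n, s.mem 10 k = 0) :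
    Runs W (forLoop 8 2 hitBody) s (20 * g.m + 2) fun s' => Marked s₀ mark c s' ∧
      ∀ k < g.n, s'.mem 10 k ≤ 1 ∧
        (s'.mem 10 k = 1 ↔ ∃ i < g.m, mark (g.src i) = k ∧ mark (g.dst i) = k + 1) := by
  refine (runs_forLoop (fun j s' => Marked s₀ mark c s' ∧ ∀ k < g.n, s'.mem 10 k ≤ 1 ∧
    (s'.mem 10 k = 1 ↔ ∃ i < j, mark (g.src i) = k ∧ mark (g.dst i) = k + 1))
    (by decide) (by omega) ?_ ((hs.1.1 2 (by decide)).trans hm) ?_).mono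
    (Nat.add_le_add_right (Nat.mul_le_mul_right _ (by decide)) _) fun _ h => h
  · rintro i s hi hr ⟨⟨h1, h7, hc⟩, h⟩
    have hms := hmark _ (g.src_lt i hi)
    have hmd := hmark _ (g.dst_lt i hi)
    have hsl := g.src_lt i hi
    have hdl := g.dst_lt i hi
    have hmem1 : s.mem 1 = g.src := (h1.2 1 (by decide)).trans hsrc
    have hmem2 : s.mem 2 = g.dst := (h1.2 2 (by decide)).trans hdst
    have hstep (k : ℕ) : (∃ l ≤ i, mark (g.src l) = k ∧ mark (g.dst l) = k + 1) ↔
        (∃ l < i, mark (g.src l) = k ∧ mark (g.dst l) = k + 1) ∨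
          (mark (g.src i) = k ∧ mark (g.dst i) = k + 1) := by
      simp only [Nat.le_iff_lt_or_eq, or_and_right, exists_or, exists_eq_left]
    simp only [hitBody, Prog.wp, Arg.val, Test.Holds, State.setReg_reg, State.setReg_mem,
      hr, hmem1, hmem2, h7]
    norm_num [hr]
    refine ⟨by omega, by omega, by omega, by omega, by omega,
      fun hd => ⟨by omega, ⟨?_, by simpa using h7, by simpa using hc⟩, fun k hk => ?_⟩,
      fun hd => ⟨⟨?_, by simpa using h7, by simpa using hc⟩, fun k hk => ?_⟩⟩
    · simpa [intact_setReg, intact_setMem] using h1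
    · rw [hstep, Function.update_apply]
      split_ifs with hkm
      · simp [hkm, hd]
      · refine ⟨(h k hk).1, (h k hk).2.trans ?_⟩
        simp [Ne.symm hkm]
    · simpa [intact_setReg, intact_setMem] using h1
    · refine ⟨(h k hk).1, (h k hk).2.trans ?_⟩
      rw [hstep, or_iff_left]
      rintro ⟨rfl, h'⟩
      exact hd h'
  · refine ⟨⟨by simpa [intact_setReg] using hs.1, hs.2.1, by simpa using hs.2.2⟩, fun k hk => ?_⟩
    simp [h0 k hk]

theorem runs_level (hc : c ≤ g.n) (hW : g.n + 1 ≤ W) {s : State} (hs : Marked s₀ mark c s)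
    {p : ℕ → Prop} (h : ∀ k < g.n, s.mem 10 k ≤ 1 ∧ (s.mem 10 k = 1 ↔ p k)) :
    Runs W (.seq (.move 13 (.lit 1)) (forLoop 8 7 levelBody)) s (10 * g.n + 3) fun s' =>
      Marked s₀ mark c s' ∧ (s'.reg 13 = 1 ↔ ∀ k, 1 ≤ k → k < c → p k) := by
  have hinit : Runs W (.move 13 (.lit 1)) s 1 fun s' => Marked s₀ mark c s' ∧
      s'.mem 10 = s.mem 10 ∧ s'.reg 13 = 1 :=
    runs_of_wp ⟨by simp only [Arg.val]; omega,
      ⟨by simpa [intact_setReg] using hs.1, hs.2.1, by simpa using hs.2.2⟩, rfl, rfl⟩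
  refine (hinit.seq fun s' hs' => (runs_forLoop (fun j t => Marked s₀ mark c t ∧
    t.mem 10 = s.mem 10 ∧ (t.reg 13 = 1 ↔ ∀ k, 1 ≤ k → k < j → p k)) (by decide)
    (hc.trans (by omega)) ?_ hs'.1.2.2 ?_).mono (T' := 10 * g.n + 2) ?_
    fun _ h => ⟨h.1, h.2.2⟩).mono (by omega) fun _ h => h
  · rintro i t hi hr ⟨⟨h1, h7, hc'⟩, h10, hp⟩
    obtain ⟨hle, hpi⟩ := h i (by omega)
    have hstep : (∀ k, 1 ≤ k → k ≤ i → p k) ↔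
        (∀ k, 1 ≤ k → k < i → p k) ∧ (1 ≤ i → p i) := by
      constructor
      · exact fun h => ⟨fun k h1 h2 => h k h1 h2.le, fun h1 => h i h1 le_rfl⟩
      · rintro ⟨ha, hb⟩ k h1 h2
        rcases (by omega : k < i ∨ k = i) with h3 | rfl
        · exact ha k h1 h3
        · exact hb h1
    simp only [levelBody, Prog.wp, Arg.val, Test.Holds, State.setReg_reg, State.setReg_mem,
      hr, h10]
    norm_num [hr, hstep]
    refine ⟨fun h0 => ⟨⟨?_, h7, by simpa using hc'⟩, ?_⟩, fun h0 => ⟨by omega,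
      fun hh => ⟨⟨?_, h7, by simpa using hc'⟩, ?_⟩,
      fun hh => ⟨⟨?_, h7, by simpa using hc'⟩, ?_⟩⟩⟩
    · simpa [intact_setReg] using h1
    · rw [hp]
      simp [h0]
    · simpa [intact_setReg] using h1
    · rw [hp]
      simp [hpi.1 hh]
    · simpa [intact_setReg] using h1
    · exact fun _ => ⟨Nat.pos_of_ne_zero h0, fun hpi' => hh (hpi.2 hpi')⟩
  · exact ⟨⟨by simpa [intact_setReg] using hs'.1.1, hs'.1.2.1, by simpa using hs'.1.2.2⟩,
      hs'.2.1, by simpa using hs'.2.2⟩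
  · exact Nat.add_le_add_right (Nat.mul_le_mul (by decide) hc) _

theorem runs_exists {f N k l : ℕ} {t : Arg} {v : ℕ} (hf : 13 ≤ f) (hN : N < 4) (hk : k < 4)
    (hl : s₀.reg N = l) (hlW : l ≤ W) (hW : 1 ≤ W)
    (ht : ∀ s, Marked s₀ mark c s → t.val s = v)
    (hs₀ : ∀ i < l, s₀.mem k i ≤ W ∧ mark (s₀.mem k i) ≤ W) {s : State}
    (hs : Marked s₀ mark c s) :
    Runs W (existsLoop f N k t) s (10 * l + 3) fun s' => Marked s₀ mark c s' ∧
      (∀ r, 13 ≤ r → r ≠ f → s'.reg r = s.reg r) ∧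
      (s'.reg f = 1 ↔ ∃ i < l, mark (s₀.mem k i) = v) := by
  have h8 : f ≠ 8 := by omega
  have h9 : f ≠ 9 := by omega
  have h7f : 7 ≠ f := by omega
  have h8f : 8 ≠ f := by omega
  have hN8 : N ≠ 8 := by omega
  have hN9 : N ≠ 9 := by omega
  have hNf : N ≠ f := by omega
  have hf4 : 4 ≤ f := by omega
  have hinit : Runs W (.move f (.lit 0)) s 1 fun s' => Marked s₀ mark c s' ∧
      (∀ r, 13 ≤ r → r ≠ f → s'.reg r = s.reg r) ∧ s'.reg f = 0 :=
    runs_of_wp ⟨Nat.zero_le _, ⟨(intact_setReg _ hf4).2 hs.1, hs.2.1,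
      by simpa [h7f] using hs.2.2⟩, fun r _ hr => by simp [hr], by simp [Arg.val]⟩
  refine (hinit.seq fun s' hs' => (runs_forLoop (fun j u => Marked s₀ mark c u ∧
    (∀ r, 13 ≤ r → r ≠ f → u.reg r = s.reg r) ∧
    (u.reg f = 1 ↔ ∃ i < j, mark (s₀.mem k i) = v)) hN8
    hlW ?_ ((hs'.1.1.1 N hN).trans hl) ?_).mono (T' := 10 * l + 2) ?_
    fun _ h => h).mono (by omega) fun _ h => h
  · rintro i u hi hr ⟨⟨h1, h7, hc⟩, hfr, hp⟩
    have hk' := h1.2 k hk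
    have hstep : (∃ j ≤ i, mark (s₀.mem k j) = v) ↔
        (∃ j < i, mark (s₀.mem k j) = v) ∨ mark (s₀.mem k i) = v := by
      simp only [Nat.le_iff_lt_or_eq, or_and_right, exists_or, exists_eq_left]
    have hv : ∀ x y, t.val ((u.setReg 9 x).setReg 9 y) = v := fun x y =>
      ht _ ⟨by simpa [intact_setReg] using h1, h7, by simpa using hc⟩
    have hreg : ∀ s r, Arg.val s (.reg r) = s.reg r := fun _ _ => rfl
    have hlit : ∀ s n, Arg.val s (.lit n) = n := fun _ _ => rfl
    simp only [Prog.wp, hreg, hlit, Test.Holds, State.setReg_reg, State.setReg_mem,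
      hr, hk', h7]
    norm_num [hr, hv, hstep, hN9, hNf, h8f, h8, h9]
    refine ⟨(hs₀ i hi).1, (hs₀ i hi).2,
      fun h => ⟨hW, ⟨?_, h7, by simpa [h7f] using hc⟩, fun r hr hrf => ?_, ?_⟩,
      fun h => ⟨⟨?_, h7, by simpa using hc⟩, fun r hr hrf => ?_, ?_⟩⟩
    · simpa [intact_setReg, hf4] using h1
    · simp [hrf, show r ≠ 8 by omega, show r ≠ 9 by omega, hfr r hr hrf]
    · exact .inr h
    · simpa [intact_setReg] using h1
    · simp [show r ≠ 8 by omega, show r ≠ 9 by omega, hfr r hr hrf]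
    · rw [hp]
      simp [h]
  · refine ⟨⟨by simpa [intact_setReg] using hs'.1.1, hs'.1.2.1, by simpa using hs'.1.2.2⟩,
      fun r hr hrf => ?_, by simp [h8, hs'.2.2]⟩
    simp [show r ≠ 8 by omega, hs'.2.1 r hr hrf]
  · simp only [Prog.cost]
    omega

theorem runs_answer (hW : 1 ≤ W) (s : State) :
    Runs W answer s 10 fun s' =>
      (s.reg 13 = 1 ∧ s.reg 14 = 1 ∧ s.reg 15 = 1 → s'.reg 0 = 1) ∧
      (¬ (s.reg 13 = 1 ∧ s.reg 14 = 1 ∧ s.reg 15 = 1) → s'.reg 0 = 0) := by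
  refine (runs_of_wp ?_).mono (by decide) fun _ h => h
  simp only [answer, Prog.wp, Arg.val, Test.Holds, State.setReg_reg]
  refine ⟨fun h1 => ⟨fun h2 => ⟨fun h3 => ?_, fun h3 => ?_⟩, fun h2 => ?_⟩, fun h1 => ?_⟩ <;>
    simp [*]

/-- The program decides the criterion of `SLT2.hasPangram_iff_of_level` for a numbering of the
strongly connected components. -/
theorem runs_pangramProg {lS lE : ℕ} (hn : s₀.reg 0 = g.n) (hlS : s₀.reg 1 = lS)
    (hm : s₀.reg 2 = g.m) (hlE : s₀.reg 3 = lE) (hsrc : s₀.mem 1 = g.src)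
    (hdst : s₀.mem 2 = g.dst) (hS : ∀ i < lS, s₀.mem 0 i < g.n) (hE : ∀ i < lE, s₀.mem 3 i < g.n)
    (hW : g.n + g.m + lS + lE + 1 ≤ W) :
    ∃ (mark : ℕ → ℕ) (c : ℕ), (∀ v < g.n, 1 ≤ mark v ∧ mark v ≤ c) ∧
      (∀ k, 1 ≤ k → k ≤ c → ∃ v < g.n, mark v = k) ∧
      (∀ u < g.n, ∀ v < g.n, mark u = mark v → g.Reach u v) ∧
      (∀ u v, g.Adj u v → mark u ≤ mark v) ∧
      Runs W pangramProg s₀ (500 * (g.n + g.m + lS + lE + 1)) fun s' =>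
        ∀ q : Prop, (q ↔ (∃ i < lS, mark (s₀.mem 0 i) = 1) ∧ (∃ i < lE, mark (s₀.mem 3 i) = c) ∧
          ∀ k, 1 ≤ k → k < c → ∃ i < g.m, mark (g.src i) = k ∧ mark (g.dst i) = k + 1) →
        (q → s'.reg 0 = 1) ∧ (¬ q → s'.reg 0 = 0) := by
  have hinit : Runs W (forLoop 8 0 (.store 9 (.reg 8) (.reg 8))) s₀ (3 * g.n + 2) fun s' =>
      Intact s₀ s' ∧ g.IsOrder (s'.mem 9) := by
    refine (runs_forLoop (fun j s' => Intact s₀ s' ∧ ∀ k < j, s'.mem 9 k = k) (by decide)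
      (by omega) ?_ hn ?_).mono le_rfl fun s' h => ⟨h.1, fun i hi => by rwa [h.2 i hi],
        fun v hv => ⟨v, hv, h.2 v hv⟩⟩
    · rintro i s hi hr ⟨h1, h⟩
      simp only [Prog.wp, Arg.val, hr]
      refine ⟨by omega, hr, rfl, ?_, ?_⟩
      · simpa [intact_setReg, intact_setMem] using h1
      · intro k hk
        simp only [State.setReg_mem, State.setMem_mem, if_true, Function.update_apply]
        split_ifs with hki
        · exact hki.symm
        · exact h k (by omega)
    · refine ⟨?_, by simp⟩
      simp only [intact_setReg, le_of_lt, Nat.reduceLT]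
      exact ⟨fun _ _ => rfl, fun _ _ => rfl⟩
  obtain ⟨t₁, s₁, hP₁, ht₁, hi₁, ho₁⟩ := hinit
  obtain ⟨t₂, s₂, hP₂, ht₂, hi₂, hr₂⟩ := runs_search (W := W) (a := 1) (b := 2) (by decide)
    (by decide) hn hm hsrc hdst (by omega) hi₁ ho₁
  obtain ⟨t₃, s₃, hP₃, ht₃, hi₃, hr₃⟩ := runs_search (g := g.reverse) (W := W) (a := 2) (b := 1)
    (by decide) (by decide) hn hm hdst hsrc (show g.n + g.m + 1 ≤ W by omega) hi₂
    ⟨hr₂.isOrder_out.lt, hr₂.isOrder_out.surj⟩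
  have hc : s₃.reg 7 ≤ g.n := hr₃.c_le
  have hmark : ∀ v < g.n, s₃.mem 7 v ≤ g.n := fun v hv => (hr₃.mark_le v hv).trans hc
  refine ⟨s₃.mem 7, s₃.reg 7, fun v hv => ⟨hr₃.mark_pos v hv, hr₃.mark_le v hv⟩,
    fun k hk hkc => ?_, fun u hu v hv => hr₂.reach_of_mark_eq hr₃ hu hv,
    fun u v huv => hr₃.mark_adj v u (EdgeList.reverse_adj.2 huv), ?_⟩
  · obtain ⟨i, hi, hik, -⟩ := hr₃.root k hk hkc
    exact ⟨_, hr₂.isOrder_out.lt i hi, hik⟩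
  have hM : Marked s₀ (s₃.mem 7) (s₃.reg 7) s₃ := ⟨hi₃, rfl, rfl⟩
  have hrest := (runs_clear (W := W) hn (by omega) hM).seq fun s h =>
    (runs_hit (W := W) hm hsrc hdst hmark (by omega) h.1 h.2).seq fun s h =>
    (runs_level (W := W) hc (by omega) h.1 h.2).seq fun s h =>
    (runs_exists (W := W) (f := 14) (N := 1) (k := 0) (t := .lit 1) (by decide) (by decide)
      (by decide) hlS (by omega) (by omega) (fun _ _ => rfl) (fun i hi =>
        have h1 := hS i hi
        have h2 := hmark _ h1
        ⟨by omega, by omega⟩) h.1).seq fun s' h' =>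
    (runs_exists (W := W) (f := 15) (N := 3) (k := 3) (t := .reg 7) (by decide) (by decide)
      (by decide) hlE (by omega) (by omega) (fun _ h => h.2.2) (fun i hi =>
        have h1 := hE i hi
        have h2 := hmark _ h1
        ⟨by omega, by omega⟩) h'.1).seq fun s'' h'' =>
    (runs_answer (W := W) (by omega) s'').mono (Q' := fun t => ∀ q : Prop,
      (q ↔ (∃ i < lS, s₃.mem 7 (s₀.mem 0 i) = 1) ∧
        (∃ i < lE, s₃.mem 7 (s₀.mem 3 i) = s₃.reg 7) ∧ ∀ k, 1 ≤ k → k < s₃.reg 7 →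
          ∃ i < g.m, s₃.mem 7 (g.src i) = k ∧ s₃.mem 7 (g.dst i) = k + 1) →
      (q → t.reg 0 = 1) ∧ (¬ q → t.reg 0 = 0)) le_rfl fun t ht q hq => by
      rw [h''.2.2, h''.2.1 14 (by decide) (by decide), h'.2.2, h''.2.1 13 (by decide) (by decide),
        h'.2.1 13 (by decide) (by decide), h.2] at ht
      rw [hq]
      exact ⟨fun h => ht.1 ⟨h.2.2, h.1, h.2.1⟩, fun h => ht.2 fun h' => h ⟨h'.2.1, h'.2.2, h'.1⟩⟩
  obtain ⟨t, s', hP, ht, hs'⟩ := hrest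
  refine ⟨_, s', .seq hP₁ (.seq hP₂ (.seq hP₃ hP)), ?_, hs'⟩
  -- Each search takes at most `200` steps per unit of size, and `500` leaves room for the rest.
  have hn' : g.reverse.n = g.n := rfl
  have hm' : g.reverse.m = g.m := rfl
  omega

end RAM

/-! ### Inputs of the machine -/

namespace SLT2Input

variable (x : SLT2Input)

theorem getD_map_val {β : Type*} {n : ℕ} {l : List β} (f : β → Fin n) {i : ℕ}
    (hi : i < l.length) : (l.map fun b => (f b : ℕ)).getD i 0 = f l[i] := by
  simp [List.getD_eq_getElem?_getD, hi]

/-- The list of `I` as an edge list. -/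
def edgeList : EdgeList where
  n := x.n
  m := x.listI.length
  src := x.encode.mem 1
  dst := x.encode.mem 2
  src_lt _ hi := (getD_map_val Prod.fst hi).trans_lt (Fin.is_lt _)
  dst_lt _ hi := (getD_map_val Prod.snd hi).trans_lt (Fin.is_lt _)

theorem exists_edge_iff {p : ℕ → ℕ → Prop} :
    (∃ i < x.edgeList.m, p (x.edgeList.src i) (x.edgeList.dst i)) ↔
      ∃ a b : Fin x.n, x.acceptor.letterGraph.Adj a b ∧ p a b := by
  have hadj (a b : Fin x.n) : x.acceptor.letterGraph.Adj a b ↔ (a, b) ∈ x.listI :=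
    List.mem_toFinset
  have hsrc {i : ℕ} (hi : i < x.listI.length) : x.edgeList.src i = x.listI[i].1 :=
    getD_map_val Prod.fst hi
  have hdst {i : ℕ} (hi : i < x.listI.length) : x.edgeList.dst i = x.listI[i].2 :=
    getD_map_val Prod.snd hi
  constructor
  · rintro ⟨i, hi, hp⟩
    rw [hsrc hi, hdst hi] at hp
    exact ⟨_, _, (hadj _ _).2 (List.getElem_mem hi), hp⟩
  · rintro ⟨a, b, hab, hp⟩
    obtain ⟨i, hi, hi'⟩ := List.getElem_of_mem ((hadj a b).1 hab)
    exact ⟨i, hi, by rwa [hsrc hi, hdst hi, hi']⟩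

theorem edgeList_adj {u v : ℕ} : x.edgeList.Adj u v ↔
    ∃ a b : Fin x.n, x.acceptor.letterGraph.Adj a b ∧ a = u ∧ b = v :=
  x.exists_edge_iff (p := fun c d => c = u ∧ d = v)

theorem reach_of_edgeList_reach {u v : ℕ} (h : x.edgeList.Reach u v) (hu : u < x.n)
    (hv : v < x.n) :
    x.acceptor.letterGraph.Reach ⟨u, hu⟩ ⟨v, hv⟩ := by
  induction h with
  | refl => exact .refl
  | tail _ hbc ih =>
    obtain ⟨a, b, hab, rfl, rfl⟩ := x.edgeList_adj.1 hbc
    exact (ih a.2).tail hab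

theorem exists_mem_iff {n : ℕ} {l : List (Fin n)} {p : ℕ → Prop} :
    (∃ i < l.length, p ((l.map Fin.val).getD i 0)) ↔ ∃ a ∈ l.toFinset, p a := by
  have hget {i : ℕ} (hi : i < l.length) : (l.map Fin.val).getD i 0 = l[i] := getD_map_val id hi
  simp only [List.mem_toFinset]
  constructor
  · rintro ⟨i, hi, hp⟩
    rw [hget hi] at hp
    exact ⟨_, List.getElem_mem hi, hp⟩
  · rintro ⟨a, ha, hp⟩
    obtain ⟨i, hi, rfl⟩ := List.getElem_of_mem ha
    exact ⟨i, hi, by rwa [hget hi]⟩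

theorem size_eq :
    x.size = x.listS.length + x.listI.length + x.listE.length + x.n := by
  simp only [size, SLT2.size, acceptor, List.toFinset_card_of_nodup x.nodupS,
    List.toFinset_card_of_nodup x.nodupI, List.toFinset_card_of_nodup x.nodupE]

end SLT2Input

theorem pangram_solvableInLinearTime :
    RAM.SolvableInLinearTime SLT2Input.encode SLT2Input.size
      (fun x : SLT2Input => x.acceptor.HasPangram) := by
  refine ⟨RAM.pangramProg, 500, fun x => ?_⟩
  have hsize := x.size_eq
  obtain ⟨mark, c, hmark, hsurj, hreach, hmono, t, s, hP, ht, hs⟩ :=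
    RAM.runs_pangramProg (g := x.edgeList) (s₀ := x.encode) (W := 500 * (x.size + 1))
      (lS := x.listS.length) (lE := x.listE.length) rfl rfl rfl rfl rfl rfl
      (fun i hi => (SLT2Input.getD_map_val id hi).trans_lt (Fin.is_lt _))
      (fun i hi => (SLT2Input.getD_map_val id hi).trans_lt (Fin.is_lt _))
      (by change x.n + x.listI.length + _ + _ + 1 ≤ _; omega)
  refine ⟨t, s, hP, ht.trans (by change 500 * (x.n + x.listI.length + _ + _ + 1) ≤ _; omega),
    hs x.acceptor.HasPangram ?_⟩
  rw [SLT2.hasPangram_iff_of_level (fun a : Fin x.n => mark a) c (fun a => hmark a a.2)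
    (fun k hk hkc => ?_)
    (fun a b hab => x.reach_of_edgeList_reach (hreach a a.2 b b.2 hab) a.2 b.2)
    (fun a b hab => hmono a b (x.edgeList_adj.2 ⟨a, b, hab, rfl, rfl⟩))]
  · refine and_congr (SLT2Input.exists_mem_iff (p := fun v => mark v = 1)).symm
      (and_congr (SLT2Input.exists_mem_iff (p := fun v => mark v = c)).symm
        (forall₃_congr fun k _ _ => ?_))
    exact (x.exists_edge_iff (p := fun u v => mark u = k ∧ mark v = k + 1)).symm
  · obtain ⟨v, hv, hvk⟩ := hsurj k hk hkc
    exact ⟨⟨v, hv⟩, hvk⟩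

theorem mainTheorem9 :
    RAM.SolvableInLinearTime SLT2Input.encode SLT2Input.size
      (fun x : SLT2Input => x.acceptor.HasPangram) ∧
    ∀ (α : Type u) [Finite α] (A : SLT2 α),
      (A.HasPangram ↔
        ∃ p : List A.letterGraph.SCC,
          A.letterGraph.condensation.IsHamiltonianPath p ∧ A.LeadsFromSToE p) ∧
      (A.HasPangram ↔
        ∃ p : List A.letterGraph.SCC,
          A.letterGraph.condensation.IsTopologicalOrder p ∧
          A.letterGraph.condensation.IsWalk p ∧ A.LeadsFromSToE p) ∧
      (∀ p : List A.letterGraph.SCC, A.letterGraph.condensation.IsHamiltonianPath p →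
        A.letterGraph.condensation.IsTopologicalOrder p ∧
        ∀ q : List A.letterGraph.SCC,
          A.letterGraph.condensation.IsTopologicalOrder q → q = p) := by
  refine ⟨pangram_solvableInLinearTime, fun α _ A => ?_⟩
  have hac := Digraph.condensation_acyclic (G := A.letterGraph)
  refine ⟨⟨fun h => h.exists_isHamiltonianPath, fun ⟨p, hp, hSE⟩ =>
      SLT2.hasPangram_of_isHamiltonianPath hp hSE⟩, ⟨fun h => ?_, fun ⟨p, hp, hw, hSE⟩ =>
      SLT2.hasPangram_of_isHamiltonianPath ⟨hw, hp.1⟩ hSE⟩,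
    fun p hp => ⟨hp.isTopologicalOrder hac, fun q hq => hq.eq_of_isHamiltonianPath hac hp⟩⟩
  obtain ⟨p, hp, hSE⟩ := h.exists_isHamiltonianPath
  exact ⟨p, hp.isTopologicalOrder hac, hp.1, hSE⟩
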